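/- Let $T_0, T_1, T_2, \dots$ be the random binary search tree process: $T_0$ consists of a single external node (the root), and, given $T_0,\dots,T_n$, the tree $T_{n+1}$ is obtained by choosing an external node of $T_n$ uniformly at random, converting it to an internal node, and giving it two new external children, one left and one right. (Thus $T_n$ has $n$ internal and $n+1$ external nodes.) Let $(\eta_L,\eta_R)$ be a random variable in $\mathbb R^d\times\mathbb R^d$ with $\mathbb E(|\eta_L|^2+|\eta_R|^2)<\infty$; $\eta_L$ and $\eta_R$ may be dependent. Let $(\eta_{vL},\eta_{vR})$, for $v$ ranging over the nodes of the infinite binary tree, be i.i.d. copies of $(\eta_L,\eta_R)$, independent of the process $(T_n)_{n\ge0}$, where $vL$ and $vR$ denote the left and right child of $v$. Define $X_o=0$ for the root $o$, and $X_w=X_v+\eta_w$ if $w$ is a child of $v$. Let $\bar\mu_n$, $\bar\mu_n^{\mathrm i}$ and $\bar\mu_n^{\mathrm e}$ be the empirical distributions of $X_v$ over all nodes, all internal nodes, and all external nodes $v$ of $T_n$, respectively; that is, with $S$ the corresponding set of nodes, the random probability measure $\frac1{|S|}\sum_{v\in S}\delta_{X_v}$ (for $\bar\mu_n^{\mathrm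 i}$, $n\ge1$). For $a>0$ and $b\in\mathbb R^d$, let $\Theta_{a,b}$ map the law of a random vector $Y$ to the law of $(Y-b)/a$. Put $m=\mathbb E\eta_L+\mathbb E\eta_R$. Then, almost surely, as $n\to\infty$, $$\Theta_{\sqrt{\log n},\,m\log n}(\bar\mu_n)\to N\bigl(0,\ \mathbb E[\eta_L\eta_L^{\mathsf T}]+\mathbb E[\eta_R\eta_R^{\mathsf T}]\bigr)$$ in the space of Borel probability measures on $\mathbb R^d$ with the weak topology. Furthermore, the same holds with $\bar\mu_n$ replaced by $\bar\mu_n^{\mathrm i}$, and with $\bar\mu_n$ replaced by $\bar\mu_n^{\mathrm e}$. -/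

import Mathlib

open MeasureTheory ProbabilityTheory Filter Topology

namespace BSTWalk

/-- Nodes of the infinite binary tree: words over `{left, right}` (`false` = left, `true` = right),
the most recent step first. The root is the empty word `[]`, and the children of `v` are
`false :: v` and `true :: v`. -/
abbrev Node : Type := List Bool

/-- The left child of a node. -/
def Node.left (v : Node) : Node := false :: v

/-- The right child of a node. -/
def Node.right (v : Node) : Node := true :: v

/-- A finite binary tree with two types of nodes, recorded by its sets of internal and external
nodes. -/
@[ext]
structure BinTree where
  internal : Finset Node
  external : Finset Node

namespace BinTree

/-- All nodes of the tree. -/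
def nodes (t : BinTree) : Finset Node := t.internal ∪ t.external

/-- The tree consisting of a single external node, the root. -/
def start : BinTree := ⟨∅, {[]}⟩

/-- Convert the external node `v` to an internal node, and add two new external nodes
as its left and right children. -/
def split (t : BinTree) (v : Node) : BinTree :=
  ⟨insert v t.internal, t.external.erase v ∪ {v.left, v.right}⟩

/-- There are only countably many trees; they carry the discrete σ-algebra. -/
instance : MeasurableSpace BinTree := ⊤

end BinTree

/-- `T 0, T 1, …` is the random binary search tree process: `T 0` is a single external node, and,
conditionally on `T 0, …, T n`, the tree `T (n + 1)` is obtained from `T n` by splitting an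
external node of `T n` chosen uniformly at random. (The conditional probability is written in
product form, for every possible history `h 0, …, h n`.) -/
structure IsRandomBST {Ω : Type*} [MeasurableSpace Ω] (P : Measure Ω)
    (T : ℕ → Ω → BinTree) : Prop where
  measurable : ∀ n, Measurable (T n)
  zero : ∀ᵐ ω ∂P, T 0 ω = BinTree.start
  step : ∀ (n : ℕ) (h : ℕ → BinTree), ∀ v ∈ (h n).external,
    P {ω | (∀ k ≤ n, T k ω = h k) ∧ T (n + 1) ω = (h n).split v} =
      P {ω | ∀ k ≤ n, T k ω = h k} / (h n).external.card

/-- The walk along the branches: `X_root = 0`, and `X_w = X_v + η_w` for a child `w` of `v`, where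
`e v = (η_{vL}, η_{vR})` is the pair of offsets of the left and right children of `v`. -/
def walk {E : Type*} [AddCommMonoid E] (e : Node → E × E) : Node → E
  | [] => 0
  | false :: v => walk e v + (e v).1
  | true :: v => walk e v + (e v).2

section Measures

variable {E : Type*} [NormedAddCommGroup E] [NormedSpace ℝ E] [MeasurableSpace E] [BorelSpace E]

/-- The empirical distribution `|S|⁻¹ ∑_{v ∈ S} δ_{X v}` of `X` over a non-empty finite set `S`
of nodes. (For `S = ∅` it is undefined, and set to `δ_0`.) -/
noncomputable def empirical (S : Finset Node) (X : Node → E) : ProbabilityMeasure E :=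
  open Classical in
  if hS : S.Nonempty then
    ⟨(S.card : ENNReal)⁻¹ • ∑ v ∈ S, Measure.dirac (X v), ⟨by
      have h0 : (S.card : ENNReal) ≠ 0 := by
        simpa using hS.ne_empty
      simp [ENNReal.inv_mul_cancel h0 (ENNReal.natCast_ne_top _)]⟩⟩
  else ⟨Measure.dirac 0, inferInstance⟩

/-- The rescaling `Θ_{a,b}`: if `Y ∼ μ` then `(Y - b) / a ∼ Θ_{a,b} μ`. -/
noncomputable def rescale (a : ℝ) (b : E) (μ : ProbabilityMeasure E) : ProbabilityMeasure E :=
  μ.map (f := fun x => a⁻¹ • (x - b))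
    (((continuous_id.sub continuous_const).const_smul a⁻¹).measurable.aemeasurable)

end Measures

/-- `m = E η_L + E η_R`, for `(η_L, η_R) ∼ ν`. -/
noncomputable def meanSum {d : ℕ}
    (ν : Measure (EuclideanSpace ℝ (Fin d) × EuclideanSpace ℝ (Fin d))) :
    EuclideanSpace ℝ (Fin d) :=
  (∫ x, x.1 ∂ν) + ∫ x, x.2 ∂ν

/-- The matrix `E[η_L η_Lᵀ] + E[η_R η_Rᵀ]`, for `(η_L, η_R) ∼ ν`. -/
noncomputable def secondMomentSum {d : ℕ}
    (ν : Measure (EuclideanSpace ℝ (Fin d) × EuclideanSpace ℝ (Fin d))) :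
    Matrix (Fin d) (Fin d) ℝ :=
  Matrix.of fun i j => (∫ x, x.1 i * x.1 j ∂ν) + ∫ x, x.2 i * x.2 j ∂ν

/-- The centred normal distribution `N(0, S)` on `ℝ^d`. -/
noncomputable def normalLaw {d : ℕ} (S : Matrix (Fin d) (Fin d) ℝ) :
    ProbabilityMeasure (EuclideanSpace ℝ (Fin d)) :=
  ⟨multivariateGaussian 0 S, inferInstance⟩

end BSTWalk

set_option linter.unusedSectionVars false

/-! The proof works with characteristic functions. Let F_n(t) be the sum of exp(i⟨X_v, t⟩) over the
external nodes v of T_n. Splitting v adds exp(i⟨X_v, t⟩) times `offspring t` of the label of v, a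
factor with mean κ = `kappa ν t`. The split node is uniform among n + 1 external nodes and its label
is independent of the past, so F_n has conditional growth factor 1 + κ/(n+1)
(`integral_mul_splitTerm`). Hence M_n = F_n / `growth κ n` is a martingale with mean 1. Put δ = 1 -
Re κ. For δ ≤ 1/4 one has E|M_n - 1|² ≤ Cδ uniformly in n (`secondMoment_le`), and Doob's inequality
bounds P(sup_n |M_n - 1| ≥ ε) by Cδ/ε² (`measure_extSum_div_growth`).

Since δ = O(|t|²), these bounds are summable in k along t = s/k, and Borel–Cantelli gives sup_n |M_n
- 1| → 0 almost surely as k → ∞. The uniformity in n permits the choice k = ⌊√(log n)⌋, so countably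
many arguments t suffice for each s. What remains is deterministic: growth(κ, n)/(n+1) behaves like
exp((κ - 1) log n) as κ → 1 (`tendsto_growth_div`), and the second order expansion of κ at 0 yields
the centring m log n and the Gaussian limit. As for a compound Poisson law, κ itself stands in the
exponent, which is why second moments appear and not covariances.

For the corresponding sum G_n over internal nodes, κG_n - F_n is a martingale up to its initial
value, with increments of mean square at most 4δ. Its increments weighted by 1/(j+1) have small
partial sums, again by Doob and Borel–Cantelli, and summation by parts gives (κG_n - F_n)/n → 0. The
statement for all nodes is a convex combination of the two.

Finally, convergence holds almost surely for each fixed s. Fubini turns this into: almost surely,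
for almost every s; and that already implies weak convergence (`tendsto_of_ae_tendsto_charFun`). -/

namespace BSTWalk

/-! ### Weak convergence from almost everywhere convergence of characteristic functions -/

section WeakConvergence

variable {E : Type*} [NormedAddCommGroup E] [InnerProductSpace ℝ E] [MeasurableSpace E]
  [BorelSpace E] [FiniteDimensional ℝ E]

lemma norm_exp_mul_I_sub_one_sq (x : ℝ) :
    ‖Complex.exp (x * Complex.I) - 1‖ ^ 2 = 2 * (1 - Real.cos x) := by
  rw [Complex.exp_mul_I, ← Complex.ofReal_cos, ← Complex.ofReal_sin, ← Complex.normSq_eq_norm_sq,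
    Complex.normSq_apply]
  simp only [Complex.sub_re, Complex.add_re, Complex.mul_re, Complex.ofReal_re, Complex.ofReal_im,
    Complex.I_re, Complex.I_im, Complex.one_re, Complex.sub_im, Complex.add_im, Complex.mul_im,
    Complex.one_im]
  nlinarith [Real.sin_sq_add_cos_sq x]

lemma integrable_exp_inner_mul_I (μ : Measure E) [IsFiniteMeasure μ] (t : E) :
    Integrable (fun x => Complex.exp (inner ℝ x t * Complex.I)) μ :=
  Integrable.of_bound (by fun_prop) 1 (ae_of_all _ fun x => by
    rw [Complex.norm_exp_ofReal_mul_I])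

lemma re_charFun (μ : Measure E) [IsFiniteMeasure μ] (t : E) :
    (charFun μ t).re = ∫ x, Real.cos (inner ℝ x t) ∂μ := by
  rw [charFun_apply]
  have := integral_re (𝕜 := ℂ) (integrable_exp_inner_mul_I μ t)
  simp only [RCLike.re_eq_complex_re] at this
  rw [← this]
  simp [Complex.exp_ofReal_mul_I_re]

lemma sq_integral_le_integral_sq {X : Type*} [MeasurableSpace X] (μ : Measure X)
    [IsProbabilityMeasure μ] {f : X → ℝ} (hf : MemLp f 2 μ) :
    (∫ x, f x ∂μ) ^ 2 ≤ ∫ x, f x ^ 2 ∂μ := by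
  have h := variance_nonneg f μ
  rw [variance_eq_sub hf] at h
  simpa using h

/-- The increments of a characteristic function are controlled by its behaviour at `0`. -/
lemma norm_charFun_add_sub_sq_le (μ : Measure E) [IsProbabilityMeasure μ] (s h : E) :
    ‖charFun μ (s + h) - charFun μ s‖ ^ 2 ≤ 2 * (1 - (charFun μ h).re) := by
  have hb : ∀ x : E, ‖Complex.exp (inner ℝ x h * Complex.I) - 1‖ ≤ 2 := fun x =>
    (norm_sub_le _ _).trans (by rw [Complex.norm_exp_ofReal_mul_I]; norm_num)
  have hcos : Integrable (fun x : E => Real.cos (inner ℝ x h)) μ :=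
    Integrable.of_bound (by fun_prop) 1 (ae_of_all _ fun x => Real.abs_cos_le_one _)
  have hd : charFun μ (s + h) - charFun μ s =
      ∫ x, Complex.exp (inner ℝ x s * Complex.I) *
        (Complex.exp (inner ℝ x h * Complex.I) - 1) ∂μ := by
    rw [charFun_apply, charFun_apply, ← integral_sub (integrable_exp_inner_mul_I μ _)
      (integrable_exp_inner_mul_I μ _)]
    refine integral_congr_ae (ae_of_all _ fun x => ?_)
    simp only [inner_add_right, Complex.ofReal_add, add_mul, Complex.exp_add]
    ring
  calc ‖charFun μ (s + h) - charFun μ s‖ ^ 2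
      ≤ (∫ x, ‖Complex.exp (inner ℝ x h * Complex.I) - 1‖ ∂μ) ^ 2 := by
        rw [hd]
        gcongr
        refine (norm_integral_le_integral_norm _).trans_eq ?_
        simp only [norm_mul, Complex.norm_exp_ofReal_mul_I, one_mul]
    _ ≤ ∫ x, ‖Complex.exp (inner ℝ x h * Complex.I) - 1‖ ^ 2 ∂μ := by
        -- Cauchy–Schwarz for a probability measure; the squared norm of exp(iy) - 1 is 2(1 - cos
        -- y), which integrates to the real part of the characteristic function.
        refine sq_integral_le_integral_sq μ (MemLp.of_bound (by fun_prop) 2 (ae_of_all _ fun x => ?_))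
        simpa using hb x
    _ = 2 * (1 - (charFun μ h).re) := by
        simp_rw [norm_exp_mul_I_sub_one_sq]
        rw [integral_const_mul, integral_sub (integrable_const _) hcos, re_charFun]
        simp

/-- Almost everywhere convergence of characteristic functions implies weak convergence. -/
lemma tendsto_of_ae_tendsto_charFun (l : Measure E) [l.IsAddHaarMeasure]
    {μ : ℕ → ProbabilityMeasure E} {μ₀ : ProbabilityMeasure E}
    (h : ∀ᵐ s ∂l, Tendsto (fun n => charFun (μ n : Measure E) s) atTop
      (𝓝 (charFun (μ₀ : Measure E) s))) :
    Tendsto μ atTop (𝓝 μ₀) := by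
  refine ProbabilityMeasure.tendsto_of_tendsto_charFun fun s => ?_
  have hs : ∀ᵐ h ∂l, Tendsto (fun n => charFun (μ n : Measure E) (s + h)) atTop
      (𝓝 (charFun (μ₀ : Measure E) (s + h))) :=
    (measurePreserving_add_left l s).quasiMeasurePreserving.ae h
  -- A conull set is dense, so there are arbitrarily small r with convergence both at r and at s +
  -- r. Convergence at r bounds the increments of all late characteristic functions over the step r,
  -- which transfers convergence from s + r to s.
  have hdense := Measure.dense_of_ae (h.and hs)
  rw [Metric.tendsto_atTop]
  intro ε hε
  have hc : Continuous (charFun (μ₀ : Measure E)) := continuous_charFun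
  have h1 : ∀ᶠ h : E in 𝓝 0, 2 * (1 - (charFun (μ₀ : Measure E) h).re) < (ε / 3) ^ 2 := by
    have : Continuous fun h : E => 2 * (1 - (charFun (μ₀ : Measure E) h).re) := by fun_prop
    refine this.continuousAt.eventually_lt continuousAt_const ?_
    simp; positivity
  have h2 : ∀ᶠ h : E in 𝓝 0,
      ‖charFun (μ₀ : Measure E) (s + h) - charFun (μ₀ : Measure E) s‖ < ε / 3 := by
    have : Continuous fun h : E =>
      ‖charFun (μ₀ : Measure E) (s + h) - charFun (μ₀ : Measure E) s‖ := by fun_prop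
    refine this.continuousAt.eventually_lt continuousAt_const ?_
    simp; positivity
  obtain ⟨r, ⟨hr3, hr4⟩, hr1, hr2⟩ := hdense.inter_nhds_nonempty (h1.and h2)
  have h3 : ∀ᶠ n in atTop, 2 * (1 - (charFun (μ n : Measure E) r).re) < (ε / 3) ^ 2 := by
    have : Tendsto (fun n => 2 * (1 - (charFun (μ n : Measure E) r).re)) atTop
        (𝓝 (2 * (1 - (charFun (μ₀ : Measure E) r).re))) :=
      (((Complex.continuous_re.tendsto _).comp hr3).const_sub 1).const_mul 2
    exact this.eventually_lt_const hr1
  have h4 : ∀ᶠ n in atTop, ‖charFun (μ n : Measure E) (s + r) -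
      charFun (μ₀ : Measure E) (s + r)‖ < ε / 3 := by
    have := (tendsto_iff_norm_sub_tendsto_zero.1 hr4)
    exact this.eventually_lt_const (by positivity)
  obtain ⟨N, hN⟩ := eventually_atTop.1 (h3.and h4)
  refine ⟨N, fun n hn => ?_⟩
  obtain ⟨h5, h6⟩ := hN n hn
  have h7 : ‖charFun (μ n : Measure E) (s + r) - charFun (μ n : Measure E) s‖ < ε / 3 :=
    lt_of_pow_lt_pow_left₀ 2 (by positivity)
      ((norm_charFun_add_sub_sq_le (μ n : Measure E) s r).trans_lt h5)
  rw [dist_eq_norm]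
  calc ‖charFun (μ n : Measure E) s - charFun (μ₀ : Measure E) s‖
      = ‖-(charFun (μ n : Measure E) (s + r) - charFun (μ n : Measure E) s)
        + (charFun (μ n : Measure E) (s + r) - charFun (μ₀ : Measure E) (s + r))
        + (charFun (μ₀ : Measure E) (s + r) - charFun (μ₀ : Measure E) s)‖ := by
        congr 1; ring
    _ ≤ _ := norm_add₃_le
    _ < ε := by rw [norm_neg]; linarith

/-- If, for each `s`, the characteristic functions of random probability measures converge at `s`
almost surely, then almost surely the measures converge weakly. -/
lemma ae_tendsto_of_forall_ae_tendsto_charFun {Ω : Type*} [MeasurableSpace Ω] (P : Measure Ω)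
    [SFinite P] {Y : ℕ → Ω → ProbabilityMeasure E} {μ₀ : ProbabilityMeasure E}
    (hY : ∀ n s, Measurable fun ω => charFun (Y n ω : Measure E) s)
    (h : ∀ s, ∀ᵐ ω ∂P, Tendsto (fun n => charFun (Y n ω : Measure E) s) atTop
      (𝓝 (charFun (μ₀ : Measure E) s))) :
    ∀ᵐ ω ∂P, Tendsto (fun n => Y n ω) atTop (𝓝 μ₀) := by
  have hm : MeasurableSet {x : E × Ω | Tendsto (fun n => charFun (Y n x.2 : Measure E) x.1 -
      charFun (μ₀ : Measure E) x.1) atTop (𝓝 0)} := by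
    refine measurableSet_tendsto _ fun n => ?_
    refine Measurable.sub ?_ (measurable_charFun.comp measurable_fst)
    -- Fubini needs joint measurability: characteristic functions are continuous in s and, by
    -- hypothesis, measurable in ω.
    exact measurable_uncurry_of_continuous_of_measurable
      (u := fun s ω => charFun (Y n ω : Measure E) s) (fun ω => continuous_charFun) (hY n)
  have h' : ∀ᵐ s ∂(Measure.addHaar : Measure E), ∀ᵐ ω ∂P, Tendsto (fun n =>
      charFun (Y n ω : Measure E) s - charFun (μ₀ : Measure E) s) atTop (𝓝 0) :=
    ae_of_all _ fun s => (h s).mono fun ω hω => by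
      simpa using hω.sub_const (charFun (μ₀ : Measure E) s)
  rw [Measure.ae_ae_comm hm] at h'
  filter_upwards [h'] with ω hω
  refine tendsto_of_ae_tendsto_charFun Measure.addHaar ?_
  filter_upwards [hω] with s hs
  simpa using hs.add_const (charFun (μ₀ : Measure E) s)

/-- Weak convergence implies convergence of characteristic functions along convergent arguments. -/
lemma tendsto_charFun_smul {μ : ℕ → ProbabilityMeasure E} {μ₀ : ProbabilityMeasure E}
    (h : Tendsto μ atTop (𝓝 μ₀)) {c : ℕ → ℝ} (hc : Tendsto c atTop (𝓝 1)) (s : E) :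
    Tendsto (fun n => charFun (μ n : Measure E) (c n • s)) atTop
      (𝓝 (charFun (μ₀ : Measure E) s)) := by
  have hs := ProbabilityMeasure.tendsto_iff_tendsto_charFun.1 h s
  -- The increment of exp(i⟨x, ·⟩) from s to c n • s is at most min(2, |ε|‖x‖) once |c n - 1|‖s‖ ≤
  -- |ε|. This majorant is a bounded continuous test function, so weak convergence controls its
  -- integral, and its integral against the limit vanishes as ε → 0.
  let g : ℝ → BoundedContinuousFunction E ℝ := fun ε =>
    BoundedContinuousFunction.ofNormedAddCommGroup (fun x => min 2 (|ε| * ‖x‖))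
      (by fun_prop) 2 (fun x => by
        rw [Real.norm_of_nonneg (by positivity)]; exact min_le_left _ _)
  have hg : ∀ ε x, g ε x = min 2 (|ε| * ‖x‖) := fun _ _ => rfl
  have hg0 : Tendsto (fun ε : ℝ => ∫ x, g ε x ∂(μ₀ : Measure E)) (𝓝 0) (𝓝 0) := by
    have : Tendsto (fun ε : ℝ => ∫ x, g ε x ∂(μ₀ : Measure E)) (𝓝 0)
        (𝓝 (∫ x, (0 : ℝ) ∂(μ₀ : Measure E))) := by
      refine tendsto_integral_filter_of_dominated_convergence (fun _ => 2)
        (Eventually.of_forall fun ε => (g ε).continuous.aestronglyMeasurable)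
        (Eventually.of_forall fun ε => ae_of_all _ fun x => ?_) (integrable_const _)
        (ae_of_all _ fun x => ?_)
      · rw [hg, Real.norm_of_nonneg (by positivity)]; exact min_le_left _ _
      · simp_rw [hg]
        have : Continuous fun ε : ℝ => min 2 (|ε| * ‖x‖) := by fun_prop
        simpa using this.tendsto 0
    simpa using this
  have key : ∀ n ε, |c n - 1| * ‖s‖ ≤ |ε| →
      ‖charFun (μ n : Measure E) (c n • s) - charFun (μ n : Measure E) s‖ ≤
        ∫ x, g ε x ∂(μ n : Measure E) := by
    intro n ε hε
    rw [charFun_apply, charFun_apply, ← integral_sub (integrable_exp_inner_mul_I _ _)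
      (integrable_exp_inner_mul_I _ _)]
    refine norm_integral_le_of_norm_le ((g ε).integrable _) (ae_of_all _ fun x => ?_)
    rw [hg]
    refine le_min ((norm_sub_le _ _).trans (by
      rw [Complex.norm_exp_ofReal_mul_I, Complex.norm_exp_ofReal_mul_I]; norm_num)) ?_
    have h1 : Complex.exp (inner ℝ x (c n • s) * Complex.I) -
        Complex.exp (inner ℝ x s * Complex.I) = Complex.exp (inner ℝ x s * Complex.I) *
        (Complex.exp (Complex.I * ((c n - 1) * inner ℝ x s : ℝ)) - 1) := by
      rw [mul_sub, ← Complex.exp_add, mul_one, inner_smul_right]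
      congr 2
      push_cast
      ring
    rw [h1, norm_mul, Complex.norm_exp_ofReal_mul_I, one_mul]
    calc _ ≤ ‖(c n - 1) * inner ℝ x s‖ := Real.norm_exp_I_mul_ofReal_sub_one_le
      _ = |c n - 1| * ‖inner ℝ x s‖ := by rw [norm_mul, Real.norm_eq_abs]
      _ ≤ |c n - 1| * (‖x‖ * ‖s‖) := by gcongr; exact norm_inner_le_norm x s
      _ = (|c n - 1| * ‖s‖) * ‖x‖ := by ring
      _ ≤ |ε| * ‖x‖ := by gcongr
  have hdiff : Tendsto (fun n => charFun (μ n : Measure E) (c n • s) -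
      charFun (μ n : Measure E) s) atTop (𝓝 0) := by
    rw [tendsto_zero_iff_norm_tendsto_zero, Metric.tendsto_atTop]
    intro η hη
    obtain ⟨ε, hε, hεη⟩ : ∃ ε : ℝ, 0 < ε ∧ ∫ x, g ε x ∂(μ₀ : Measure E) < η := by
      have := (hg0.eventually_lt_const hη).filter_mono (nhdsWithin_le_nhds (s := Set.Ioi 0))
      obtain ⟨ε, h1, h2⟩ := (this.and self_mem_nhdsWithin).exists
      exact ⟨ε, h2, h1⟩
    have h1 := (ProbabilityMeasure.tendsto_iff_forall_integral_tendsto.1 h (g ε)).eventually_lt_const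
      hεη
    have h2 : ∀ᶠ n in atTop, |c n - 1| * ‖s‖ < ε := by
      have : Tendsto (fun n => |c n - 1| * ‖s‖) atTop (𝓝 (|1 - 1| * ‖s‖)) :=
        ((hc.sub_const 1).abs).mul_const _
      simp only [sub_self, abs_zero, zero_mul] at this
      exact this.eventually_lt_const hε
    obtain ⟨N, hN⟩ := eventually_atTop.1 (h1.and h2)
    refine ⟨N, fun n hn => ?_⟩
    rw [dist_zero_right, norm_norm]
    exact (key n ε ((hN n hn).2.le.trans (le_abs_self _))).trans_lt (hN n hn).1
  simpa using hdiff.add hs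

end WeakConvergence

/-! ### Asymptotics of the mean growth and the second moment recursion -/

section Growth

/-- The product `∏_{k=1}^n (1 + κ / k)`. -/
noncomputable def growth (κ : ℂ) (n : ℕ) : ℂ := ∏ k ∈ Finset.range n, (1 + κ / (k + 1))

lemma growth_zero (κ : ℂ) : growth κ 0 = 1 := by simp [growth]

lemma growth_succ (κ : ℂ) (n : ℕ) : growth κ (n + 1) = growth κ n * (1 + κ / (n + 1)) := by
  simp [growth, Finset.prod_range_succ]

/-- Factor by factor, Bernoulli's inequality bounds (1 + 1/(n+1))^(1-δ) by 1 + (1-δ)/(n+1), the real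
part of the next factor. -/
lemma rpow_le_norm_growth {κ : ℂ} {δ : ℝ} (hδ0 : 0 ≤ δ) (hδ1 : δ ≤ 1) (hκ : κ.re = 1 - δ) (n : ℕ) :
    ((n : ℝ) + 1) ^ (1 - δ) ≤ ‖growth κ n‖ := by
  induction n with
  | zero => simp [growth]
  | succ n ih =>
    have hn : (0 : ℝ) < n + 1 := by positivity
    rw [growth_succ, norm_mul]
    have h1 : ((n : ℝ) + 1 + 1) ^ (1 - δ) =
        ((n : ℝ) + 1) ^ (1 - δ) * (1 + 1 / ((n : ℝ) + 1)) ^ (1 - δ) := by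
      rw [← Real.mul_rpow (by positivity) (by positivity)]
      congr 1
      field_simp
    have h2 : (1 + 1 / ((n : ℝ) + 1)) ^ (1 - δ) ≤ ‖1 + κ / (n + 1)‖ := by
      calc _ ≤ 1 + (1 - δ) * (1 / ((n : ℝ) + 1)) :=
            _root_.rpow_one_add_le_one_add_mul_self (le_trans (by norm_num)
              (show (0 : ℝ) ≤ 1 / ((n : ℝ) + 1) by positivity)) (by linarith) (by linarith)
        _ = (1 + κ / (n + 1)).re := by
            have : κ / ((n : ℂ) + 1) = κ / (((n : ℝ) + 1 : ℝ) : ℂ) := by push_cast; rfl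
            rw [this, Complex.add_re, Complex.div_ofReal_re, hκ]
            simp [div_eq_mul_inv]
        _ ≤ _ := Complex.re_le_norm _
    push_cast
    rw [h1]
    gcongr

lemma growth_ne_zero {κ : ℂ} {δ : ℝ} (hδ0 : 0 ≤ δ) (hδ1 : δ ≤ 1) (hκ : κ.re = 1 - δ) (n : ℕ) :
    growth κ n ≠ 0 := by
  rw [← norm_pos_iff]
  exact lt_of_lt_of_le (by positivity) (rpow_le_norm_growth hδ0 hδ1 hκ n)

/-- The squared mean obeys the recursion of the second moment, except that the additive term β of
the latter is replaced by ‖κ‖²‖growth κ n‖²/(n+1)². -/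
lemma norm_growth_succ_sq (κ : ℂ) (n : ℕ) :
    ‖growth κ (n + 1)‖ ^ 2 =
      ‖growth κ n‖ ^ 2 * (1 + 2 * κ.re / (n + 1) + ‖κ‖ ^ 2 / (n + 1) ^ 2) := by
  have hn : (0 : ℝ) < n + 1 := by positivity
  rw [growth_succ, norm_mul, mul_pow]
  congr 1
  have : κ / ((n : ℂ) + 1) = κ / (((n : ℝ) + 1 : ℝ) : ℂ) := by push_cast; rfl
  rw [← Complex.normSq_eq_norm_sq, ← Complex.normSq_eq_norm_sq, this, Complex.normSq_apply,
    Complex.normSq_apply, Complex.add_re, Complex.add_im, Complex.div_ofReal_re,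
    Complex.div_ofReal_im]
  simp only [Complex.one_re, Complex.one_im]
  field_simp
  ring

/-- The constant `∑_n 12 (n + 2)^{-5/4}` in the bound on second moments. -/
noncomputable def momentConst : ℝ := ∑' n : ℕ, 12 * ((n : ℝ) + 2) ^ (-(5 / 4) : ℝ)

lemma summable_momentConst : Summable fun n : ℕ => 12 * ((n : ℝ) + 2) ^ (-(5 / 4) : ℝ) := by
  refine Summable.mul_left _ ?_
  have := (summable_nat_add_iff 2).2 (Real.summable_nat_rpow (p := -(5 / 4))|>.2 (by norm_num))
  simpa using this

lemma sum_le_momentConst (n : ℕ) :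
    ∑ j ∈ Finset.range n, 12 * ((j : ℝ) + 2) ^ (-(5 / 4) : ℝ) ≤ momentConst :=
  summable_momentConst.sum_le_tsum _ fun _ _ => by positivity

/-- The left side is the excess of the second moment recursion over that of the squared mean. Since
‖growth κ n‖²/(n+1)² ≥ (n+1)^(-2δ) ≥ 1 - 2δ log(n+1), the excess is at most δ(4 + 2 log(n+1)); a
small power then absorbs the logarithm. -/
lemma sub_norm_growth_sq_le {κ : ℂ} {δ β : ℝ} (hδ0 : 0 ≤ δ) (hδ1 : δ ≤ 1) (hκ : κ.re = 1 - δ)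
    (hβ : β ≤ 1 + 2 * δ) (n : ℕ) :
    β - ‖κ‖ ^ 2 * ‖growth κ n‖ ^ 2 / (n + 1) ^ 2 ≤ δ * (12 * ((n : ℝ) + 2) ^ (1 / 4 : ℝ)) := by
  have hn : (0 : ℝ) < n + 1 := by positivity
  have hlog : 0 ≤ Real.log (n + 1) := Real.log_nonneg (by linarith)
  have h1 : (1 - δ) ^ 2 ≤ ‖κ‖ ^ 2 := by
    have : 1 - δ ≤ ‖κ‖ := hκ ▸ Complex.re_le_norm κ
    exact pow_le_pow_left₀ (by linarith) this 2
  have h2 : Real.exp (-(2 * δ * Real.log (n + 1))) ≤ ‖growth κ n‖ ^ 2 / (n + 1) ^ 2 := by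
    rw [le_div_iff₀ (by positivity)]
    have h3 : Real.exp (-(2 * δ * Real.log (n + 1))) * ((n : ℝ) + 1) ^ 2 =
        (((n : ℝ) + 1) ^ (1 - δ)) ^ 2 := by
      rw [← Real.rpow_natCast, ← Real.rpow_natCast, ← Real.rpow_mul hn.le,
        Real.rpow_def_of_pos hn, Real.rpow_def_of_pos hn, ← Real.exp_add]
      congr 1
      push_cast
      ring
    rw [h3]
    exact pow_le_pow_left₀ (by positivity) (rpow_le_norm_growth hδ0 hδ1 hκ n) 2
  have h3 : 1 - 2 * δ * Real.log (n + 1) ≤ Real.exp (-(2 * δ * Real.log (n + 1))) := by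
    have := Real.add_one_le_exp (-(2 * δ * Real.log (n + 1)))
    linarith
  have h4 : Real.exp (-(2 * δ * Real.log (n + 1))) ≤ 1 :=
    Real.exp_le_one_iff.2 (by simp only [Left.neg_nonpos_iff]; positivity)
  have h5 : (1 - δ) ^ 2 * Real.exp (-(2 * δ * Real.log (n + 1))) ≤
      ‖κ‖ ^ 2 * ‖growth κ n‖ ^ 2 / (n + 1) ^ 2 := by
    rw [mul_div_assoc]
    gcongr
  -- This is (1 - a)(1 - b) ≥ 0 for a = (1-δ)² and b the exponential, both at most 1.
  have h6 : (1 - δ) ^ 2 + Real.exp (-(2 * δ * Real.log (n + 1))) - 1 ≤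
      (1 - δ) ^ 2 * Real.exp (-(2 * δ * Real.log (n + 1))) := by
    nlinarith [mul_nonneg (sub_nonneg.2 h4) (show 0 ≤ 1 - (1 - δ) ^ 2 by nlinarith)]
  have h7 : Real.log (n + 1) ≤ 4 * ((n : ℝ) + 2) ^ (1 / 4 : ℝ) := by
    calc Real.log (n + 1) ≤ Real.log (n + 2) := Real.log_le_log hn (by linarith)
      _ ≤ ((n : ℝ) + 2) ^ (1 / 4 : ℝ) / (1 / 4) :=
          Real.log_le_rpow_div (by positivity) (by norm_num)
      _ = _ := by ring
  have h8 : (1 : ℝ) ≤ ((n : ℝ) + 2) ^ (1 / 4 : ℝ) :=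
    Real.one_le_rpow (by linarith) (by norm_num)
  have h9 : β - ‖κ‖ ^ 2 * ‖growth κ n‖ ^ 2 / (n + 1) ^ 2 ≤ δ * (4 + 2 * Real.log (n + 1)) := by
    nlinarith
  refine h9.trans (mul_le_mul_of_nonneg_left ?_ hδ0)
  linarith

/-- The second moments of the total weight, normalised by the square of its mean. -/
lemma secondMoment_le {κ : ℂ} {δ β : ℝ} (hδ0 : 0 ≤ δ) (hδ1 : δ ≤ 1 / 4) (hκ : κ.re = 1 - δ)
    (hβ : β ≤ 1 + 2 * δ) {w : ℕ → ℝ} (hw0 : w 0 = 1)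
    (hw : ∀ n, w (n + 1) = w n * (1 + 2 * κ.re / (n + 1)) + β) (n : ℕ) :
    w n ≤ ‖growth κ n‖ ^ 2 * (1 + momentConst * δ) := by
  have hδ1' : δ ≤ 1 := by linarith
  have key : ∀ n, w n ≤ ‖growth κ n‖ ^ 2 *
      (1 + (∑ j ∈ Finset.range n, 12 * ((j : ℝ) + 2) ^ (-(5 / 4) : ℝ)) * δ) := by
    intro n
    induction n with
    | zero => simp [hw0, growth]
    | succ n ih =>
      have hn : (0 : ℝ) < n + 1 := by positivity
      rw [hw, Finset.sum_range_succ]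
      set c := ∑ j ∈ Finset.range n, 12 * ((j : ℝ) + 2) ^ (-(5 / 4) : ℝ) with hc
      have hc0 : 0 ≤ c := Finset.sum_nonneg fun _ _ => by positivity
      set b := ‖growth κ n‖ ^ 2 with hb
      have hb0 : 0 ≤ b := by positivity
      have hp : 0 ≤ 1 + 2 * κ.re / (n + 1) := by
        have : 0 ≤ κ.re := by rw [hκ]; linarith
        positivity
      have h1 := sub_norm_growth_sq_le hδ0 hδ1' hκ hβ n
      have h2 : ((n : ℝ) + 2) ^ (3 / 2 : ℝ) ≤ ‖growth κ (n + 1)‖ ^ 2 := by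
        have h3 := rpow_le_norm_growth hδ0 hδ1' hκ (n + 1)
        -- Here δ ≤ 1/4 is used. The squared mean then grows at least like n^(3/2), so the excess δ
        -- n^(1/4) relative to it is of order δ n^(-5/4), which is summable.
        have h4 : ((n : ℝ) + 2) ^ (3 / 4 : ℝ) ≤ ‖growth κ (n + 1)‖ := by
          refine le_trans ?_ h3
          push_cast
          rw [show (n : ℝ) + 1 + 1 = n + 2 by ring]
          exact Real.rpow_le_rpow_of_exponent_le (by linarith) (by linarith)
        calc ((n : ℝ) + 2) ^ (3 / 2 : ℝ) = (((n : ℝ) + 2) ^ (3 / 4 : ℝ)) ^ 2 := by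
              rw [← Real.rpow_natCast, ← Real.rpow_mul (by positivity)]; norm_num
          _ ≤ _ := pow_le_pow_left₀ (by positivity) h4 2
      have h5 : ((n : ℝ) + 2) ^ (1 / 4 : ℝ) =
          ((n : ℝ) + 2) ^ (3 / 2 : ℝ) * ((n : ℝ) + 2) ^ (-(5 / 4) : ℝ) := by
        rw [← Real.rpow_add (by positivity)]; norm_num
      have h6 : δ * (12 * ((n : ℝ) + 2) ^ (1 / 4 : ℝ)) ≤
          ‖growth κ (n + 1)‖ ^ 2 * (12 * ((n : ℝ) + 2) ^ (-(5 / 4) : ℝ) * δ) := by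
        rw [h5]
        calc _ = ((n : ℝ) + 2) ^ (3 / 2 : ℝ) * (12 * ((n : ℝ) + 2) ^ (-(5 / 4) : ℝ) * δ) := by ring
          _ ≤ _ := by gcongr
      have h7 := norm_growth_succ_sq κ n
      rw [← hb] at h7 h1
      have h8 : ‖growth κ (n + 1)‖ ^ 2 = b * (1 + 2 * κ.re / (n + 1)) +
          ‖κ‖ ^ 2 * b / (n + 1) ^ 2 := by rw [h7]; ring
      have h9 : b * (1 + 2 * κ.re / (n + 1)) ≤ ‖growth κ (n + 1)‖ ^ 2 := by
        rw [h8]; linarith [show 0 ≤ ‖κ‖ ^ 2 * b / ((n : ℝ) + 1) ^ 2 by positivity]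
      calc w n * (1 + 2 * κ.re / (n + 1)) + β
          ≤ b * (1 + c * δ) * (1 + 2 * κ.re / (n + 1)) + β := by gcongr
        _ = b * (1 + 2 * κ.re / (n + 1)) * (c * δ) + ‖growth κ (n + 1)‖ ^ 2 +
            (β - ‖κ‖ ^ 2 * b / (n + 1) ^ 2) := by rw [h8]; ring
        _ ≤ ‖growth κ (n + 1)‖ ^ 2 * (c * δ) + ‖growth κ (n + 1)‖ ^ 2 +
            ‖growth κ (n + 1)‖ ^ 2 * (12 * ((n : ℝ) + 2) ^ (-(5 / 4) : ℝ) * δ) := by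
            gcongr
            exact h1.trans h6
        _ = _ := by ring
  refine (key n).trans ?_
  gcongr
  exact sum_le_momentConst n

/-- Each factor splits as (k+2)/(k+1) · (1 + θ/(k+2)), and the first parts telescope to n + 1. -/
lemma growth_one_add_div (θ : ℂ) (n : ℕ) :
    growth (1 + θ) n / (n + 1) = ∏ k ∈ Finset.range n, (1 + θ / (k + 2)) := by
  induction n with
  | zero => simp [growth]
  | succ n ih =>
    have h1 : (n : ℂ) + 1 ≠ 0 := by exact_mod_cast Nat.succ_ne_zero n
    have h2 : (n : ℂ) + 2 ≠ 0 := by exact_mod_cast Nat.succ_ne_zero (n + 1)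
    have h3 : (n : ℂ) + 1 + 1 ≠ 0 := by rwa [add_assoc, one_add_one_eq_two]
    rw [Finset.prod_range_succ, ← ih, growth_succ]
    push_cast
    field_simp
    ring

lemma sum_inv_sq_le (n : ℕ) : ∑ k ∈ Finset.range n, 1 / ((k : ℝ) + 1) ^ 2 ≤ 2 := by
  have key : ∀ n : ℕ, ∑ k ∈ Finset.range (n + 1), 1 / ((k : ℝ) + 1) ^ 2 ≤
      2 - 1 / ((n : ℝ) + 1) := by
    intro n
    induction n with
    | zero => norm_num
    | succ n ih =>
      rw [Finset.sum_range_succ]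
      have : 1 / (((n + 1 : ℕ) : ℝ) + 1) ^ 2 ≤ 1 / ((n : ℝ) + 1) - 1 / (((n + 1 : ℕ) : ℝ) + 1) := by
        push_cast
        rw [div_sub_div _ _ (by positivity) (by positivity), div_le_div_iff₀ (by positivity)
          (by positivity)]
        nlinarith [show (0 : ℝ) ≤ n by positivity]
      linarith
  cases n with
  | zero => simp
  | succ n => exact (key n).trans (by linarith [show (0 : ℝ) ≤ 1 / ((n : ℝ) + 1) by positivity])

lemma tendsto_sum_inv_sub_log :
    Tendsto (fun n : ℕ => ∑ k ∈ Finset.range n, 1 / ((k : ℝ) + 2) - Real.log n) atTop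
      (𝓝 (Real.eulerMascheroniConstant - 1)) := by
  have h1 := Real.tendsto_harmonic_sub_log
  have h2 : Tendsto (fun n : ℕ => 1 / ((n : ℝ) + 1)) atTop (𝓝 0) :=
    tendsto_one_div_add_atTop_nhds_zero_nat
  have h3 := (h1.add h2).sub_const 1
  rw [add_zero] at h3
  refine h3.congr fun n => ?_
  have : ∀ n : ℕ, ((harmonic n : ℚ) : ℝ) + 1 / ((n : ℝ) + 1) - 1 =
      ∑ k ∈ Finset.range n, 1 / ((k : ℝ) + 2) := by
    intro n
    induction n with
    | zero => simp
    | succ n ih =>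
      rw [Finset.sum_range_succ, ← ih, harmonic_succ]
      push_cast
      rw [add_assoc (n : ℝ) 1 1, one_add_one_eq_two, one_div, one_div]
      ring
  rw [← this]
  ring

/-- Taking logarithms in `growth_one_add_div`, the linear terms give θ n · (log n + O(1)) and the
quadratic ones O(‖θ n‖²), so θ n → 0 leaves only θ n · log n. The sequence z carries the divergent
imaginary part, which cannot be removed before the limit. -/
lemma tendsto_growth_div {θ z : ℕ → ℂ} {l : ℂ} (hθ : Tendsto θ atTop (𝓝 0))
    (hz : Tendsto (fun n => θ n * Real.log n - z n) atTop (𝓝 l)) :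
    Tendsto (fun n : ℕ => growth (1 + θ n) n / (n + 1) * Complex.exp (-z n)) atTop
      (𝓝 (Complex.exp l)) := by
  have hsmall : ∀ᶠ n in atTop, ‖θ n‖ < 1 / 2 := by
    have := tendsto_zero_iff_norm_tendsto_zero.1 hθ
    exact this.eventually_lt_const (by norm_num)
  have hterm : ∀ n, ‖θ n‖ < 1 / 2 → ∀ k : ℕ, ‖θ n / ((k : ℂ) + 2)‖ ≤ ‖θ n‖ / (k + 1) := by
    intro n _ k
    rw [norm_div]
    have : ‖(k : ℂ) + 2‖ = (k : ℝ) + 2 := by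
      have : (k : ℂ) + 2 = ((k + 2 : ℕ) : ℂ) := by push_cast; rfl
      rw [this, Complex.norm_natCast]; push_cast; rfl
    rw [this]
    gcongr
    norm_num
  have hle1 : ∀ n, ‖θ n‖ < 1 / 2 → ∀ k : ℕ, ‖θ n / ((k : ℂ) + 2)‖ < 1 / 2 := by
    intro n hn k
    refine ((hterm n hn k).trans (div_le_self (norm_nonneg _) ?_)).trans_lt hn
    linarith [show (0 : ℝ) ≤ k by positivity]
  have hexp : ∀ n, ‖θ n‖ < 1 / 2 → growth (1 + θ n) n / (n + 1) =
      Complex.exp (∑ k ∈ Finset.range n, Complex.log (1 + θ n / (k + 2))) := by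
    -- Only exp(log w) = w is used, so no branch of the logarithm matters; it suffices that no
    -- factor vanishes.
    intro n hn
    rw [growth_one_add_div, Complex.exp_sum]
    refine Finset.prod_congr rfl fun k _ => (Complex.exp_log fun h0 => ?_).symm
    have h1 : θ n / ((k : ℂ) + 2) = -1 := by linear_combination h0
    have h2 := hle1 n hn k
    rw [h1, norm_neg, norm_one] at h2
    norm_num at h2
  have herr : Tendsto (fun n => ∑ k ∈ Finset.range n, (Complex.log (1 + θ n / (k + 2)) -
      θ n / (k + 2))) atTop (𝓝 0) := by
    have h1 : Tendsto (fun n => 2 * ‖θ n‖ ^ 2) atTop (𝓝 0) := by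
      simpa using ((tendsto_zero_iff_norm_tendsto_zero.1 hθ).pow 2).const_mul 2
    refine squeeze_zero_norm' ?_ h1
    filter_upwards [hsmall] with n hn
    calc _ ≤ ∑ k ∈ Finset.range n, ‖θ n‖ ^ 2 * (1 / ((k : ℝ) + 1) ^ 2) := by
          refine norm_sum_le_of_le _ fun k _ => ?_
          have h2 := hle1 n hn k
          refine (Complex.norm_log_one_add_sub_self_le (h2.trans (by norm_num))).trans ?_
          have h3 : (1 - ‖θ n / ((k : ℂ) + 2)‖)⁻¹ ≤ 2 := by
            rw [inv_le_comm₀ (by linarith) (by norm_num)]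
            linarith
          calc _ ≤ ‖θ n / ((k : ℂ) + 2)‖ ^ 2 * 2 / 2 := by gcongr
            _ = ‖θ n / ((k : ℂ) + 2)‖ ^ 2 := by ring
            _ ≤ (‖θ n‖ / (k + 1)) ^ 2 := by gcongr; exact hterm n hn k
            _ = _ := by rw [div_pow]; ring
      _ = ‖θ n‖ ^ 2 * ∑ k ∈ Finset.range n, 1 / ((k : ℝ) + 1) ^ 2 := by rw [Finset.mul_sum]
      _ ≤ ‖θ n‖ ^ 2 * 2 := by gcongr; exact sum_inv_sq_le n
      _ = _ := by ring
  have hlin : Tendsto (fun n : ℕ => θ n * ((∑ k ∈ Finset.range n, 1 / ((k : ℝ) + 2) - Real.log n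
      : ℝ) : ℂ)) atTop (𝓝 0) := by
    simpa using hθ.mul ((Complex.continuous_ofReal.tendsto _).comp tendsto_sum_inv_sub_log)
  have hall := (Complex.continuous_exp.tendsto _).comp ((herr.add hlin).add hz)
  rw [zero_add, zero_add] at hall
  refine hall.congr' ?_
  filter_upwards [hsmall] with n hn
  rw [hexp n hn, ← Complex.exp_add]
  simp only [Function.comp_apply]
  congr 1
  rw [Finset.sum_sub_distrib]
  push_cast
  have : ∑ k ∈ Finset.range n, θ n / ((k : ℂ) + 2) = θ n * ∑ k ∈ Finset.range n, 1 / ((k : ℂ) + 2) := by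
    rw [Finset.mul_sum]
    exact Finset.sum_congr rfl fun k _ => by ring
  rw [this]
  ring

/-- Summation by parts: a bound on weighted partial sums bounds the unweighted ones. -/
lemma norm_sum_le_of_norm_sum_div_le {D : ℕ → ℂ} {ε : ℝ}
    (h : ∀ n, ‖∑ j ∈ Finset.range n, D j / (j + 1)‖ ≤ ε) (n : ℕ) :
    ‖∑ j ∈ Finset.range n, D j‖ ≤ 2 * n * ε := by
  have key : ∀ n : ℕ, ∑ j ∈ Finset.range n, D j = n * ∑ j ∈ Finset.range n, D j / (j + 1) -
      ∑ i ∈ Finset.range n, ∑ j ∈ Finset.range i, D j / (j + 1) := by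
    intro n
    induction n with
    | zero => simp
    | succ n ih =>
      have h1 : (n : ℂ) + 1 ≠ 0 := by exact_mod_cast Nat.succ_ne_zero n
      rw [Finset.sum_range_succ, ih, Finset.sum_range_succ, Finset.sum_range_succ _ n]
      push_cast
      field_simp
      ring
  rw [key]
  calc _ ≤ ‖(n : ℂ) * ∑ j ∈ Finset.range n, D j / (j + 1)‖ +
        ‖∑ i ∈ Finset.range n, ∑ j ∈ Finset.range i, D j / (j + 1)‖ := norm_sub_le _ _
    _ ≤ n * ε + ∑ i ∈ Finset.range n, ε := by
        gcongr
        · rw [norm_mul, Complex.norm_natCast]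
          gcongr
          exact h n
        · exact norm_sum_le_of_le _ fun i _ => h i
    _ = _ := by simp; ring

end Growth

/-! ### The integer scale -/

section Scale

/-- An integer approximation of the scale `√(log n)`. -/
noncomputable def scale (n : ℕ) : ℕ := ⌊√(Real.log n)⌋₊

lemma tendsto_sqrt_log : Tendsto (fun n : ℕ => √(Real.log n)) atTop atTop :=
  Real.tendsto_sqrt_atTop.comp (Real.tendsto_log_atTop.comp tendsto_natCast_atTop_atTop)

lemma tendsto_scale : Tendsto scale atTop atTop :=
  tendsto_nat_floor_atTop.comp tendsto_sqrt_log

lemma tendsto_scale_div : Tendsto (fun n : ℕ => (scale n : ℝ) / √(Real.log n)) atTop (𝓝 1) :=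
  tendsto_nat_floor_div_atTop.comp tendsto_sqrt_log

lemma tendsto_log_div_scale_sq :
    Tendsto (fun n : ℕ => Real.log n / (scale n : ℝ) ^ 2) atTop (𝓝 1) := by
  have h := (tendsto_scale_div.inv₀ one_ne_zero).pow 2
  simp only [inv_one, one_pow] at h
  refine h.congr fun n => ?_
  rw [inv_div, div_pow, Real.sq_sqrt (Real.log_natCast_nonneg n)]

end Scale

/-! ### The label of a split node: moments and expansion of the growth rate -/

section Offspring

variable {E : Type*} [NormedAddCommGroup E] [InnerProductSpace ℝ E]

/-- The character `x ↦ exp(i⟨x, t⟩)`. -/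
noncomputable def phase (t x : E) : ℂ := Complex.exp (inner ℝ x t * Complex.I)

@[simp] lemma norm_phase (t x : E) : ‖phase t x‖ = 1 := Complex.norm_exp_ofReal_mul_I _

@[simp] lemma phase_apply_zero (t : E) : phase t 0 = 1 := by simp [phase]

@[simp] lemma phase_zero_left (x : E) : phase 0 x = 1 := by simp [phase]

lemma phase_add (t x y : E) : phase t (x + y) = phase t x * phase t y := by
  rw [phase, phase, phase, ← Complex.exp_add, inner_add_left]
  push_cast
  ring_nf

lemma re_phase (t x : E) : (phase t x).re = Real.cos (inner ℝ x t) :=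
  Complex.exp_ofReal_mul_I_re _

lemma continuous_phase (t : E) : Continuous (phase t) := by
  unfold phase; fun_prop

/-- The change of the sum of characters over external nodes when the root is split. -/
noncomputable def offspring (t : E) (x : E × E) : ℂ := phase t x.1 + phase t x.2 - 1

lemma continuous_offspring (t : E) : Continuous (offspring t) := by
  unfold offspring
  have := continuous_phase t
  fun_prop

lemma norm_offspring_le (t : E) (x : E × E) : ‖offspring t x‖ ≤ 3 := by
  refine (norm_sub_le _ _).trans ?_
  have := norm_add_le (phase t x.1) (phase t x.2)
  rw [norm_phase, norm_phase] at this
  rw [norm_one]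
  linarith

/-- For unit numbers a and b, |a + b - 1|² = 3 + 2 Re(a b̄) - 2 Re a - 2 Re b, and Re(a b̄) ≤ 1. -/
lemma norm_offspring_sq_le (t : E) (x : E × E) :
    ‖offspring t x‖ ^ 2 ≤ 1 + 2 * (1 - (offspring t x).re) := by
  have h : ∀ y, (phase t y).re ^ 2 + (phase t y).im ^ 2 = 1 := fun y => by
    have := Complex.normSq_eq_norm_sq (phase t y)
    rw [norm_phase, Complex.normSq_apply] at this
    nlinarith
  have h1 := h x.1
  have h2 := h x.2
  rw [← Complex.normSq_eq_norm_sq, Complex.normSq_apply]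
  simp only [offspring, Complex.sub_re, Complex.add_re, Complex.sub_im, Complex.add_im,
    Complex.one_re, Complex.one_im]
  nlinarith [sq_nonneg ((phase t x.1).re - (phase t x.2).re),
    sq_nonneg ((phase t x.1).im - (phase t x.2).im)]

variable [MeasurableSpace E] [BorelSpace E] [SecondCountableTopology E]

lemma measurable_offspring (t : E) : Measurable (offspring t) :=
  (continuous_offspring t).measurable

variable (ν : Measure (E × E))

/-- The mean growth rate of the sum of characters over external nodes. -/
noncomputable def kappa (t : E) : ℂ := ∫ x, offspring t x ∂ν

variable [IsProbabilityMeasure ν]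

lemma integrable_offspring (t : E) : Integrable (offspring t) ν :=
  Integrable.of_bound (measurable_offspring t).aestronglyMeasurable 3
    (ae_of_all _ (norm_offspring_le t))

lemma integrable_norm_offspring_sq (t : E) : Integrable (fun x => ‖offspring t x‖ ^ 2) ν := by
  refine Integrable.of_bound ((measurable_offspring t).norm.pow_const 2).aestronglyMeasurable 9
    (ae_of_all _ fun x => ?_)
  rw [Real.norm_of_nonneg (by positivity)]
  nlinarith [norm_offspring_le t x, norm_nonneg (offspring t x)]

lemma re_kappa (t : E) : (kappa ν t).re = ∫ x, (offspring t x).re ∂ν := by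
  have := integral_re (𝕜 := ℂ) (integrable_offspring ν t)
  simp only [RCLike.re_eq_complex_re] at this
  exact this.symm

lemma one_sub_re_kappa (t : E) : 1 - (kappa ν t).re = ∫ x, (1 - (offspring t x).re) ∂ν := by
  have h := (integrable_offspring ν t).re
  simp only [RCLike.re_eq_complex_re] at h
  rw [re_kappa, integral_sub (integrable_const _) h]
  simp

lemma one_sub_re_kappa_nonneg (t : E) : 0 ≤ 1 - (kappa ν t).re := by
  rw [one_sub_re_kappa]
  refine integral_nonneg fun x => ?_
  simp only [offspring, Complex.sub_re, Complex.add_re, re_phase, Complex.one_re, Pi.zero_apply]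
  linarith [Real.cos_le_one (inner ℝ x.1 t), Real.cos_le_one (inner ℝ x.2 t)]

/-- Only cosines enter the real part, so the means of the labels contribute nothing at first order.
The quadratic bound is what makes the failure probabilities summable along t = s/k. -/
lemma one_sub_re_kappa_le (hν : Integrable (fun x => ‖x.1‖ ^ 2 + ‖x.2‖ ^ 2) ν) (t : E) :
    1 - (kappa ν t).re ≤ ‖t‖ ^ 2 * ∫ x, (‖x.1‖ ^ 2 + ‖x.2‖ ^ 2) ∂ν := by
  rw [one_sub_re_kappa, ← integral_const_mul]
  have h := (integrable_const (μ := ν) (1 : ℝ)).sub (integrable_offspring ν t).re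
  refine integral_mono h (hν.const_mul _) fun x => ?_
  have hb : ∀ y : E, 1 - Real.cos (inner ℝ y t) ≤ ‖t‖ ^ 2 * ‖y‖ ^ 2 := fun y => by
    have h1 := Real.one_sub_sq_div_two_le_cos (x := inner ℝ y t)
    have h2 : (inner ℝ y t) ^ 2 ≤ (‖y‖ * ‖t‖) ^ 2 := by
      rw [← sq_abs]
      exact pow_le_pow_left₀ (abs_nonneg _) (abs_real_inner_le_norm y t) 2
    nlinarith [sq_nonneg (‖y‖ * ‖t‖)]
  simp only [offspring, Complex.sub_re, Complex.add_re, re_phase, Complex.one_re]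
  linarith [hb x.1, hb x.2]

lemma integral_norm_offspring_sq_le (t : E) :
    ∫ x, ‖offspring t x‖ ^ 2 ∂ν ≤ 1 + 2 * (1 - (kappa ν t).re) := by
  have h := (integrable_const (μ := ν) (1 : ℝ)).sub (integrable_offspring ν t).re
  calc _ ≤ ∫ x, (1 + 2 * (1 - (offspring t x).re)) ∂ν :=
        integral_mono (integrable_norm_offspring_sq ν t)
          ((integrable_const (μ := ν) (1 : ℝ)).add (h.const_mul 2)) (norm_offspring_sq_le t)
    _ = _ := by
      have h2 := integral_add (integrable_const (μ := ν) (1 : ℝ)) (h.const_mul 2)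
      simp only [Pi.sub_apply, RCLike.re_eq_complex_re] at h2
      rw [h2, one_sub_re_kappa, integral_const_mul]
      simp

/-- The second moment `E⟨η_L, s⟩² + E⟨η_R, s⟩²`. -/
noncomputable def quadForm (s : E) : ℝ := (∫ x, inner ℝ x.1 s ^ 2 ∂ν) + ∫ x, inner ℝ x.2 s ^ 2 ∂ν

lemma charFun_map_inner {X : E × E → E} (hX : Measurable X) (s : E) (c : ℝ) :
    charFun (ν.map fun x => inner ℝ (X x) s) c = ∫ x, phase (c • s) (X x) ∂ν := by
  have hm : Measurable fun x => inner ℝ (X x) s :=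
    ((continuous_id.inner continuous_const).measurable).comp hX
  rw [charFun_apply_real, integral_map hm.aemeasurable (by fun_prop)]
  simp only [phase, inner_smul_right]
  push_cast
  rfl

/-- Along the ray through s this is the characteristic function of the real variable ⟨X, s⟩, which
is C² because of the second moment; Taylor's formula with Peano remainder applies. -/
lemma isLittleO_integral_phase {X : E × E → E} (hX : Measurable X)
    (hX2 : Integrable (fun x => ‖X x‖ ^ 2) ν) (s : E) :
    (fun c : ℝ => (∫ x, phase (c • s) (X x) ∂ν) -
      (1 + ((∫ x, inner ℝ (X x) s ∂ν : ℝ) : ℂ) * c * Complex.I -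
        ((∫ x, inner ℝ (X x) s ^ 2 ∂ν : ℝ) : ℂ) * c ^ 2 / 2)) =o[𝓝 0] fun c => c ^ 2 := by
  have hm : Measurable fun x => inner ℝ (X x) s :=
    ((continuous_id.inner continuous_const).measurable).comp hX
  have hmem : MemLp (fun x => inner ℝ (X x) s) 2 ν := by
    refine (memLp_two_iff_integrable_sq hm.aestronglyMeasurable).2 ?_
    refine (hX2.mul_const (‖s‖ ^ 2)).mono' (hm.pow_const 2).aestronglyMeasurable
      (ae_of_all _ fun x => ?_)
    rw [Real.norm_of_nonneg (by positivity), ← mul_pow, ← sq_abs]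
    exact pow_le_pow_left₀ (abs_nonneg _) (abs_real_inner_le_norm _ _) 2
  have hmem' : MemLp id 2 (ν.map fun x => inner ℝ (X x) s) := by
    rw [memLp_map_measure_iff aestronglyMeasurable_id hm.aemeasurable]
    exact hmem
  have : IsProbabilityMeasure (ν.map fun x => inner ℝ (X x) s) :=
    Measure.isProbabilityMeasure_map hm.aemeasurable
  have key := taylor_isLittleO_univ (contDiff_charFun (n := 2) hmem') (x₀ := 0)
  simp only [sub_zero] at key
  refine key.congr_left fun c => ?_
  rw [taylorWithinEval_charFun_two_zero hm.aemeasurable hmem', charFun_map_inner ν hX]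
  simp

variable {ν}

lemma integrable_of_norm_sq {X : E × E → E} (hX : AEStronglyMeasurable X ν)
    (hX2 : Integrable (fun x => ‖X x‖ ^ 2) ν) : Integrable X ν :=
  ((memLp_two_iff_integrable_sq_norm hX).2 hX2).integrable (by norm_num)

lemma integrable_fst_sq (hν : Integrable (fun x => ‖x.1‖ ^ 2 + ‖x.2‖ ^ 2) ν) :
    Integrable (fun x : E × E => ‖x.1‖ ^ 2) ν :=
  hν.mono' (by fun_prop) (ae_of_all _ fun x => by
    rw [Real.norm_of_nonneg (by positivity)]; linarith [sq_nonneg ‖x.2‖])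

lemma integrable_snd_sq (hν : Integrable (fun x => ‖x.1‖ ^ 2 + ‖x.2‖ ^ 2) ν) :
    Integrable (fun x : E × E => ‖x.2‖ ^ 2) ν :=
  hν.mono' (by fun_prop) (ae_of_all _ fun x => by
    rw [Real.norm_of_nonneg (by positivity)]; linarith [sq_nonneg ‖x.1‖])

lemma integrable_phase_comp (t : E) {X : E × E → E} (hX : Measurable X) :
    Integrable (fun x => phase t (X x)) ν :=
  Integrable.of_bound ((continuous_phase t).measurable.comp hX).aestronglyMeasurable 1
    (ae_of_all _ fun x => by rw [norm_phase])

/-- Second order expansion of the growth rate at `0`. -/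
lemma tendsto_kappa_expansion [CompleteSpace E]
    (hν : Integrable (fun x => ‖x.1‖ ^ 2 + ‖x.2‖ ^ 2) ν) (s : E) :
    Tendsto (fun c : ℝ => (kappa ν (c • s) - 1 -
      c * (inner ℝ ((∫ x, x.1 ∂ν) + ∫ x, x.2 ∂ν) s : ℝ) * Complex.I) / c ^ 2) (𝓝[≠] 0)
      (𝓝 (-(quadForm ν s : ℂ) / 2)) := by
  have h1 := isLittleO_integral_phase ν measurable_fst (integrable_fst_sq hν) s
  have h2 := isLittleO_integral_phase ν measurable_snd (integrable_snd_sq hν) s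
  have h3 := (h1.add h2).mono (nhdsWithin_le_nhds (s := {0}ᶜ))
  have i1 : Integrable (fun x : E × E => x.1) ν :=
    integrable_of_norm_sq (by fun_prop) (integrable_fst_sq hν)
  have i2 : Integrable (fun x : E × E => x.2) ν :=
    integrable_of_norm_sq (by fun_prop) (integrable_snd_sq hν)
  have h4 : Tendsto (fun c : ℝ => (((∫ x, phase (c • s) x.1 ∂ν) -
      (1 + ((∫ x, inner ℝ x.1 s ∂ν : ℝ) : ℂ) * c * Complex.I -
        ((∫ x, inner ℝ x.1 s ^ 2 ∂ν : ℝ) : ℂ) * c ^ 2 / 2)) +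
      ((∫ x, phase (c • s) x.2 ∂ν) -
      (1 + ((∫ x, inner ℝ x.2 s ∂ν : ℝ) : ℂ) * c * Complex.I -
        ((∫ x, inner ℝ x.2 s ^ 2 ∂ν : ℝ) : ℂ) * c ^ 2 / 2))) / (c : ℂ) ^ 2) (𝓝[≠] 0) (𝓝 0) := by
    refine (Asymptotics.isLittleO_iff_tendsto' ?_).1 ?_
    · filter_upwards [self_mem_nhdsWithin] with c hc h0
      simp at h0
      exact absurd h0 hc
    · refine h3.trans_isBigO ?_
      refine Asymptotics.IsBigO.of_bound 1 (Eventually.of_forall fun c => ?_)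
      simp
  have h6 := h4.add_const (-(quadForm ν s : ℂ) / 2)
  rw [zero_add] at h6
  refine h6.congr' ?_
  filter_upwards [self_mem_nhdsWithin] with c hc
  have hc' : (c : ℂ) ≠ 0 := by simpa using hc
  have hk : kappa ν (c • s) = (∫ x, phase (c • s) x.1 ∂ν) + (∫ x, phase (c • s) x.2 ∂ν) - 1 := by
    have j1 := integrable_phase_comp (ν := ν) (c • s) measurable_fst
    have j2 := integrable_phase_comp (ν := ν) (c • s) measurable_snd
    simp only [kappa, offspring]
    have j3 := integral_sub (j1.add j2) (integrable_const (1 : ℂ))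
    simp only [Pi.add_apply] at j3
    rw [j3, integral_add j1 j2]
    simp
  have hm : (inner ℝ ((∫ x, x.1 ∂ν) + ∫ x, x.2 ∂ν) s : ℝ) =
      (∫ x, inner ℝ x.1 s ∂ν) + ∫ x, inner ℝ x.2 s ∂ν := by
    rw [inner_add_left, real_inner_comm, real_inner_comm s, ← integral_inner i1, ← integral_inner i2]
    simp_rw [real_inner_comm s]
  rw [hk, hm, quadForm]
  push_cast
  field_simp
  ring

end Offspring

/-! ### The characteristic function of the limit law -/

section Gaussian

variable {d : ℕ} {ν : Measure (EuclideanSpace ℝ (Fin d) × EuclideanSpace ℝ (Fin d))}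
  [IsProbabilityMeasure ν]

lemma integrable_mul_of_norm_sq
    {X : EuclideanSpace ℝ (Fin d) × EuclideanSpace ℝ (Fin d) → EuclideanSpace ℝ (Fin d)}
    (hX : Measurable X) (hX2 : Integrable (fun x => ‖X x‖ ^ 2) ν) (i j : Fin d) :
    Integrable (fun x => X x i * X x j) ν := by
  have hm : ∀ i, Measurable fun x => X x i := fun i =>
    (EuclideanSpace.proj i : EuclideanSpace ℝ (Fin d) →L[ℝ] ℝ).continuous.measurable.comp hX
  refine hX2.mono' ((hm i).mul (hm j)).aestronglyMeasurable (ae_of_all _ fun x => ?_)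
  rw [norm_mul]
  nlinarith [PiLp.norm_apply_le (X x) i, PiLp.norm_apply_le (X x) j, norm_nonneg (X x i),
    norm_nonneg (X x j)]

lemma integral_inner_sq
    {X : EuclideanSpace ℝ (Fin d) × EuclideanSpace ℝ (Fin d) → EuclideanSpace ℝ (Fin d)}
    (hX : Measurable X) (hX2 : Integrable (fun x => ‖X x‖ ^ 2) ν) (s : EuclideanSpace ℝ (Fin d)) :
    ∫ x, inner ℝ (X x) s ^ 2 ∂ν = ∑ i, ∑ j, s i * ((∫ x, X x i * X x j ∂ν) * s j) := by
  have h : ∀ x, inner ℝ (X x) s ^ 2 = ∑ i, ∑ j, s i * ((X x i * X x j) * s j) := fun x => by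
    rw [PiLp.inner_apply, sq, Finset.sum_mul_sum]
    refine Finset.sum_congr rfl fun i _ => Finset.sum_congr rfl fun j _ => ?_
    simp
    ring
  simp_rw [h]
  have hi := integrable_mul_of_norm_sq hX hX2
  rw [integral_finsetSum _ fun i _ => integrable_finsetSum _ fun j _ =>
    ((hi i j).mul_const _).const_mul _]
  refine Finset.sum_congr rfl fun i _ => ?_
  rw [integral_finsetSum _ fun j _ => ((hi i j).mul_const _).const_mul _]
  refine Finset.sum_congr rfl fun j _ => ?_
  rw [integral_const_mul, integral_mul_const]

lemma dotProduct_secondMomentSum (hν : Integrable (fun x => ‖x.1‖ ^ 2 + ‖x.2‖ ^ 2) ν)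
    (s : EuclideanSpace ℝ (Fin d)) :
    s.ofLp ⬝ᵥ (secondMomentSum ν).mulVec s.ofLp = quadForm ν s := by
  rw [quadForm, integral_inner_sq measurable_fst (integrable_fst_sq hν),
    integral_inner_sq measurable_snd (integrable_snd_sq hν)]
  simp only [dotProduct, Matrix.mulVec, secondMomentSum, Matrix.of_apply, Finset.mul_sum, add_mul,
    mul_add, Finset.sum_add_distrib]

lemma posSemidef_secondMomentSum (hν : Integrable (fun x => ‖x.1‖ ^ 2 + ‖x.2‖ ^ 2) ν) :
    (secondMomentSum ν).PosSemidef := by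
  refine Matrix.PosSemidef.of_dotProduct_mulVec_nonneg ?_ fun x => ?_
  · ext i j
    simp [secondMomentSum, mul_comm]
  · have := dotProduct_secondMomentSum hν (WithLp.toLp 2 x)
    simp only [star_trivial]
    rw [this, quadForm]
    exact add_nonneg (integral_nonneg fun _ => sq_nonneg _) (integral_nonneg fun _ => sq_nonneg _)

lemma charFun_normalLaw (hν : Integrable (fun x => ‖x.1‖ ^ 2 + ‖x.2‖ ^ 2) ν)
    (s : EuclideanSpace ℝ (Fin d)) :
    charFun (normalLaw (secondMomentSum ν) : Measure (EuclideanSpace ℝ (Fin d))) s =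
      Complex.exp (-(quadForm ν s : ℂ) / 2) := by
  change charFun (multivariateGaussian 0 (secondMomentSum ν)) s = _
  rw [charFun_multivariateGaussian (posSemidef_secondMomentSum hν), dotProduct_secondMomentSum hν]
  simp [neg_div]

end Gaussian

/-! ### Combinatorics of the trees -/

section Trees

namespace BinTree

/-- The invariants of the trees occurring in the process. -/
structure Proper (t : BinTree) : Prop where
  disjoint : Disjoint t.internal t.external
  card : t.external.card = t.internal.card + 1
  parent : ∀ b v, b :: v ∈ t.nodes → v ∈ t.internal

lemma proper_start : start.Proper where
  disjoint := by simp [start]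
  card := by simp [start]
  parent := by simp [start, nodes]

variable {t : BinTree} {v w : Node}

lemma Proper.notMem_internal (ht : t.Proper) (hv : v ∈ t.external) : v ∉ t.internal :=
  fun h => Finset.disjoint_left.1 ht.disjoint h hv

lemma Proper.cons_notMem_nodes (ht : t.Proper) (hv : v ∈ t.external) (b : Bool) :
    b :: v ∉ t.nodes := fun h => ht.notMem_internal hv (ht.parent b v h)

lemma Proper.cons_notMem_external (ht : t.Proper) (hv : v ∈ t.external) (b : Bool) :
    b :: v ∉ t.external :=
  fun h => ht.cons_notMem_nodes hv b (Finset.mem_union_right _ h)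

/-- The split node is the only new internal node, hence can be read off the new tree. So the events
of splitting different external nodes are disjoint. -/
lemma Proper.split_injective_of_mem (ht : t.Proper) (hv : v ∈ t.external)
    (h : t.split v = t.split w) : v = w := by
  have h1 : insert v t.internal = insert w t.internal := congrArg BinTree.internal h
  have h2 : v ∈ insert w t.internal := h1 ▸ Finset.mem_insert_self v _
  exact (Finset.mem_insert.1 h2).resolve_right (ht.notMem_internal hv)

lemma Proper.disjoint_children (ht : t.Proper) (hv : v ∈ t.external) :
    Disjoint (t.external.erase v) {v.left, v.right} := by
  rw [Finset.disjoint_right]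
  intro x hx hx'
  simp only [Finset.mem_insert, Finset.mem_singleton] at hx
  rcases hx with rfl | rfl <;> exact ht.cons_notMem_external hv _ (Finset.mem_of_mem_erase hx')

lemma left_ne_right (v : Node) : v.left ≠ v.right := by simp [Node.left, Node.right]

lemma Proper.split (ht : t.Proper) (hv : v ∈ t.external) : (t.split v).Proper where
  disjoint := by
    rw [Finset.disjoint_left]
    intro x hx hx'
    simp only [BinTree.split, Finset.mem_insert, Finset.mem_union, Finset.mem_erase,
      Finset.mem_singleton, Node.left, Node.right] at hx hx'
    have hl : ∀ b, b :: v ∉ t.internal := fun b h =>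
      ht.cons_notMem_nodes hv b (Finset.mem_union_left _ h)
    rcases hx with rfl | hx
    · simp at hx'
    · rcases hx' with hx' | rfl | rfl
      · exact ht.notMem_internal hx'.2 hx
      · exact hl _ hx
      · exact hl _ hx
  card := by
    have h1 : 0 < t.external.card := Finset.card_pos.2 ⟨v, hv⟩
    rw [BinTree.split, Finset.card_union_of_disjoint (ht.disjoint_children hv),
      Finset.card_erase_of_mem hv, Finset.card_pair (left_ne_right v),
      Finset.card_insert_of_notMem (ht.notMem_internal hv)]
    have := ht.card
    omega
  parent := by
    intro b w hw
    simp only [nodes, BinTree.split, Finset.mem_insert, Finset.mem_union, Finset.mem_erase,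
      Finset.mem_singleton, Node.left, Node.right, List.cons.injEq] at hw ⊢
    rcases hw with (h | h) | h | h | h
    · exact Or.inr (ht.parent b w (Finset.mem_union_right _ (h ▸ hv)))
    · exact Or.inr (ht.parent b w (Finset.mem_union_left _ h))
    · exact Or.inr (ht.parent b w (Finset.mem_union_right _ h.2))
    · exact Or.inl h.2
    · exact Or.inl h.2

instance : Countable BinTree :=
  Function.Injective.countable (f := fun t : BinTree => (t.internal, t.external)) fun a b h => by
    simp only [Prod.mk.injEq] at h
    exact BinTree.ext h.1 h.2

instance : DiscreteMeasurableSpace BinTree := ⟨fun _ => trivial⟩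

end BinTree

/-- The sequence `h` is, up to time `n`, a possible history of the process. -/
def Valid (h : ℕ → BinTree) (n : ℕ) : Prop :=
  h 0 = BinTree.start ∧ ∀ k < n, ∃ v ∈ (h k).external, h (k + 1) = (h k).split v

variable {h : ℕ → BinTree} {n : ℕ}

lemma Valid.mono {m : ℕ} (hv : Valid h n) (hmn : m ≤ n) : Valid h m :=
  ⟨hv.1, fun k hk => hv.2 k (hk.trans_le hmn)⟩

lemma Valid.congr {h' : ℕ → BinTree} (hv : Valid h n) (hh : ∀ k ≤ n, h k = h' k) : Valid h' n :=
  ⟨hh 0 (Nat.zero_le n) ▸ hv.1, fun k hk => by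
    rw [← hh k hk.le, ← hh (k + 1) hk]; exact hv.2 k hk⟩

lemma Valid.proper (hv : Valid h n) : (h n).Proper := by
  induction n with
  | zero => rw [hv.1]; exact BinTree.proper_start
  | succ n ih =>
    obtain ⟨v, hv1, hv2⟩ := hv.2 n (Nat.lt_succ_self n)
    rw [hv2]
    exact (ih (hv.mono n.le_succ)).split hv1

lemma Valid.card_internal (hv : Valid h n) : (h n).internal.card = n := by
  induction n with
  | zero => rw [hv.1]; rfl
  | succ n ih =>
    obtain ⟨v, hv1, hv2⟩ := hv.2 n (Nat.lt_succ_self n)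
    have hn := hv.mono n.le_succ
    rw [hv2, BinTree.split, Finset.card_insert_of_notMem (hn.proper.notMem_internal hv1), ih hn]

lemma Valid.card_external (hv : Valid h n) : (h n).external.card = n + 1 := by
  rw [hv.proper.card, hv.card_internal]

lemma Valid.internal_subset (hv : Valid h (n + 1)) : (h n).internal ⊆ (h (n + 1)).internal := by
  obtain ⟨v, -, hv2⟩ := hv.2 n (Nat.lt_succ_self n)
  rw [hv2]
  exact Finset.subset_insert _ _

/-- The position of a node involves only the labels of its proper ancestors, which are all internal.
-/
lemma walk_congr {E : Type*} [AddCommMonoid E] {t : BinTree} (ht : t.Proper) {x y : Node → E × E}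
    (hxy : ∀ u ∈ t.internal, x u = y u) {v : Node} (hv : v ∈ t.nodes) : walk x v = walk y v := by
  induction v with
  | nil => rfl
  | cons b w ih =>
    have hw := ht.parent b w hv
    cases b <;> simp [walk, ih (Finset.mem_union_left _ hw), hxy w hw]

end Trees

/-! ### Character sums under a split -/

section CharSum

variable {E : Type*} [NormedAddCommGroup E] [InnerProductSpace ℝ E]

/-- The sum of a character over the positions of a finite set of nodes. -/
noncomputable def charSum (t : E) (S : Finset Node) (x : Node → E × E) : ℂ :=
  ∑ v ∈ S, phase t (walk x v)

lemma norm_charSum_le (t : E) (S : Finset Node) (x : Node → E × E) : ‖charSum t S x‖ ≤ S.card := by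
  refine (norm_sum_le _ _).trans ?_
  simp

lemma charSum_zero_left (S : Finset Node) (x : Node → E × E) : charSum 0 S x = S.card := by
  simp [charSum]

lemma charSum_external_split (t : E) {τ : BinTree} (hτ : τ.Proper) {v : Node} (hv : v ∈ τ.external)
    (x : Node → E × E) : charSum t (τ.split v).external x =
      charSum t τ.external x + phase t (walk x v) * offspring t (x v) := by
  have h1 : charSum t (τ.split v).external x = charSum t (τ.external.erase v) x +
      (phase t (walk x v.left) + phase t (walk x v.right)) := by
    rw [charSum, BinTree.split, Finset.sum_union (hτ.disjoint_children hv),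
      Finset.sum_pair (BinTree.left_ne_right v)]
    rfl
  have h2 : charSum t (τ.external.erase v) x + phase t (walk x v) = charSum t τ.external x :=
    Finset.sum_erase_add _ _ hv
  rw [h1, ← h2, Node.left, Node.right, walk, walk, phase_add, phase_add, offspring]
  ring

lemma charSum_internal_split (t : E) {τ : BinTree} (hτ : τ.Proper) {v : Node} (hv : v ∈ τ.external)
    (x : Node → E × E) : charSum t (τ.split v).internal x =
      charSum t τ.internal x + phase t (walk x v) := by
  rw [charSum, BinTree.split, Finset.sum_insert (hτ.notMem_internal hv), add_comm]
  rfl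

/-- The sum of `phase t (walk x v) * f (x v)` over the external nodes `v` of `τ` that are split
in passing from `τ` to `τ'`. -/
noncomputable def increment (t : E) (f : E × E → ℂ) (τ τ' : BinTree) (x : Node → E × E) : ℂ :=
  open Classical in
  ∑ v ∈ τ.external, if τ' = τ.split v then phase t (walk x v) * f (x v) else 0

lemma increment_split (t : E) (f : E × E → ℂ) {τ : BinTree} (hτ : τ.Proper) {v : Node}
    (hv : v ∈ τ.external) (x : Node → E × E) :
    increment t f τ (τ.split v) x = phase t (walk x v) * f (x v) := by
  classical
  rw [increment, Finset.sum_eq_single_of_mem v hv]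
  · simp
  · intro w _ hwv
    rw [if_neg fun h => hwv (hτ.split_injective_of_mem hv h).symm]

variable [MeasurableSpace E] [BorelSpace E] [SecondCountableTopology E]

lemma measurable_walk (v : Node) : Measurable fun x : Node → E × E => walk x v := by
  induction v with
  | nil => exact measurable_const
  | cons b w ih =>
    cases b
    · exact ih.add (measurable_fst.comp (measurable_pi_apply w))
    · exact ih.add (measurable_snd.comp (measurable_pi_apply w))

lemma measurable_phase_walk (t : E) (v : Node) :
    Measurable fun x : Node → E × E => phase t (walk x v) :=
  (continuous_phase t).measurable.comp (measurable_walk v)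

lemma measurable_charSum (t : E) (S : Finset Node) :
    Measurable fun x : Node → E × E => charSum t S x :=
  Finset.measurable_sum _ fun v _ => measurable_phase_walk t v

lemma measurable_increment (t : E) {f : E × E → ℂ} (hf : Measurable f) (τ τ' : BinTree) :
    Measurable fun x : Node → E × E => increment t f τ τ' x := by
  classical
  refine Finset.measurable_sum _ fun v _ => ?_
  split_ifs
  · exact (measurable_phase_walk t v).mul (hf.comp (measurable_pi_apply v))
  · exact measurable_const

end CharSum

/-! ### Decomposition of the sample space by tree histories -/

section Histories

variable {Ω : Type*} [MeasurableSpace Ω]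

lemma measurable_apply_countable {β γ : Type*} [Countable β] [MeasurableSpace β]
    [DiscreteMeasurableSpace β] [MeasurableSpace γ] {Y : Ω → β} (hY : Measurable Y)
    {Ψ : β → Ω → γ} (hΨ : ∀ b, Measurable (Ψ b)) : Measurable fun ω => Ψ (Y ω) ω := by
  intro s hs
  have : (fun ω => Ψ (Y ω) ω) ⁻¹' s = ⋃ b, Y ⁻¹' {b} ∩ Ψ b ⁻¹' s := by
    ext ω
    simp
  rw [this]
  exact MeasurableSet.iUnion fun b => (hY (measurableSet_singleton b)).inter (hΨ b hs)

/-- The event that the first `n + 1` trees are `h 0, …, h n`. -/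
def cell (T : ℕ → Ω → BinTree) (n : ℕ) (h : ℕ → BinTree) : Set Ω := {ω | ∀ k ≤ n, T k ω = h k}

/-- A sequence of trees with prescribed initial segment. -/
def extendHistory {n : ℕ} (g : Fin (n + 1) → BinTree) (k : ℕ) : BinTree :=
  g ⟨min k n, by omega⟩

variable {P : Measure Ω} {T : ℕ → Ω → BinTree}

lemma cell_subset {m n : ℕ} (hmn : m ≤ n) (h : ℕ → BinTree) : cell T n h ⊆ cell T m h :=
  fun _ hω k hk => hω k (hk.trans hmn)

lemma mem_cell_extendHistory {n : ℕ} {g : Fin (n + 1) → BinTree} {ω : Ω} :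
    ω ∈ cell T n (extendHistory g) ↔ (fun k : Fin (n + 1) => T k ω) = g := by
  constructor
  · intro hω
    ext1 k
    have := hω k (Nat.lt_succ_iff.1 k.2)
    rw [this, extendHistory]
    congr 1
    ext
    simp only
    omega
  · rintro rfl k hk
    simp [extendHistory, min_eq_left hk]

lemma iUnion_cell (n : ℕ) : ⋃ g : Fin (n + 1) → BinTree, cell T n (extendHistory g) = Set.univ := by
  ext ω
  simp only [Set.mem_iUnion, Set.mem_univ, iff_true]
  exact ⟨_, mem_cell_extendHistory.2 rfl⟩

lemma pairwise_disjoint_cell (n : ℕ) : Pairwise (Function.onFun Disjoint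
    fun g : Fin (n + 1) → BinTree => cell T n (extendHistory g)) := by
  intro g g' hgg'
  refine Set.disjoint_left.2 fun ω h1 h2 => hgg' ?_
  rw [← mem_cell_extendHistory.1 h1, mem_cell_extendHistory.1 h2]

lemma IsRandomBST.measurableSet_cell
    (hT : IsRandomBST P T) (n : ℕ) (h : ℕ → BinTree) : MeasurableSet (cell T n h) := by
  have : cell T n h = ⋂ k, ⋂ (_ : k ≤ n), T k ⁻¹' {h k} := by
    ext ω; simp [cell]
  rw [this]
  exact MeasurableSet.iInter fun k => MeasurableSet.iInter fun _ =>
    hT.measurable k (measurableSet_singleton _)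

/-- The n + 1 possible splits are disjoint events inside the cell, each with a fraction 1/(n+1) of
its probability; together they exhaust the cell up to a null set. -/
lemma IsRandomBST.ae_step_of_valid [IsProbabilityMeasure P]
    (hT : IsRandomBST P T) {n : ℕ} {h : ℕ → BinTree}
    (hv : Valid h n) : ∀ᵐ ω ∂P, ω ∈ cell T n h →
      ∃ v ∈ (h n).external, T (n + 1) ω = (h n).split v := by
  set A : Node → Set Ω := fun v => {ω | (∀ k ≤ n, T k ω = h k) ∧ T (n + 1) ω = (h n).split v}
  have hA : ∀ v, MeasurableSet (A v) := fun v => (hT.measurableSet_cell n h).inter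
    (hT.measurable (n + 1) (measurableSet_singleton ((h n).split v)))
  have hdisj : Set.PairwiseDisjoint (↑(h n).external) A := by
    intro v hv' w _ hvw
    refine Set.disjoint_left.2 fun ω h1 h2 => hvw ?_
    exact hv.proper.split_injective_of_mem hv' (h1.2.symm.trans h2.2)
  have hU : P (⋃ v ∈ (h n).external, A v) = P (cell T n h) := by
    rw [measure_biUnion_finset hdisj fun v _ => hA v,
      Finset.sum_congr rfl fun v hv' => hT.step n h v hv', Finset.sum_const, nsmul_eq_mul]
    refine ENNReal.mul_div_cancel ?_ (ENNReal.natCast_ne_top _)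
    rw [hv.card_external]
    exact_mod_cast n.succ_ne_zero
  have hsub : (⋃ v ∈ (h n).external, A v) ⊆ cell T n h := by
    intro ω hω
    simp only [Set.mem_iUnion] at hω
    obtain ⟨v, -, hω⟩ := hω
    exact hω.1
  have hnull : P (cell T n h \ ⋃ v ∈ (h n).external, A v) = 0 := by
    rw [measure_sdiff hsub ((h n).external.measurableSet_biUnion fun v _ => hA v).nullMeasurableSet
      (measure_ne_top _ _), hU, tsub_self]
  rw [ae_iff]
  refine measure_mono_null (fun ω hω => ?_) hnull
  simp only [Set.mem_ofPred_eq, not_forall] at hω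
  obtain ⟨h1, h2⟩ := hω
  refine ⟨h1, fun h3 => h2 ?_⟩
  simp only [Set.mem_iUnion] at h3
  obtain ⟨v, hv', h4⟩ := h3
  exact ⟨v, hv', h4.2⟩

lemma IsRandomBST.ae_valid [IsProbabilityMeasure P]
    (hT : IsRandomBST P T) :
    ∀ᵐ ω ∂P, ∀ n, Valid (fun k => T k ω) n := by
  rw [ae_all_iff]
  intro n
  induction n with
  | zero =>
    filter_upwards [hT.zero] with ω hω
    exact ⟨hω, fun k hk => absurd hk (Nat.not_lt_zero k)⟩
  | succ n ih =>
    have h1 : ∀ᵐ ω ∂P, ∀ g : Fin (n + 1) → BinTree, Valid (extendHistory g) n →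
        ω ∈ cell T n (extendHistory g) → ∃ v ∈ (extendHistory g n).external,
          T (n + 1) ω = (extendHistory g n).split v := by
      rw [ae_all_iff]
      intro g
      by_cases hg : Valid (extendHistory g) n
      · filter_upwards [hT.ae_step_of_valid hg] with ω hω _ using hω
      · exact ae_of_all _ fun ω h => absurd h hg
    filter_upwards [ih, h1] with ω h2 h3
    have hmem : ω ∈ cell T n (extendHistory fun k : Fin (n + 1) => T k ω) :=
      mem_cell_extendHistory.2 rfl
    obtain ⟨v, hv1, hv2⟩ := h3 _ (h2.congr hmem) hmem
    rw [← hmem n le_rfl] at hv1 hv2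
    refine ⟨h2.1, fun k hk => ?_⟩
    rcases Nat.lt_succ_iff_lt_or_eq.1 hk with hk | rfl
    · exact h2.2 k hk
    · exact ⟨v, hv1, hv2⟩

lemma IsRandomBST.measure_cell_of_not_valid [IsProbabilityMeasure P]
    (hT : IsRandomBST P T) {n : ℕ} {h : ℕ → BinTree}
    (hv : ¬ Valid h n) : P (cell T n h) = 0 := by
  refine measure_mono_null (fun ω hω => ?_) (ae_iff.1 hT.ae_valid)
  exact fun h' => hv ((h' n).congr hω)

/-- There are countably many cells, they partition the sample space, and those of invalid histories
are null. Conditioning on the trees thus reduces to integration over cells. -/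
lemma IsRandomBST.integral_eq_of_cells [IsProbabilityMeasure P]
    (hT : IsRandomBST P T) (n : ℕ) {f g : Ω → ℂ}
    (hf : Integrable f P) (hg : Integrable g P)
    (h : ∀ h, Valid h n → ∫ ω in cell T n h, f ω ∂P = ∫ ω in cell T n h, g ω ∂P) :
    ∫ ω, f ω ∂P = ∫ ω, g ω ∂P := by
  have key : ∀ u : Ω → ℂ, Integrable u P → ∫ ω, u ω ∂P =
      ∑' c : Fin (n + 1) → BinTree, ∫ ω in cell T n (extendHistory c), u ω ∂P := by
    intro u hu
    rw [← integral_iUnion (fun c => hT.measurableSet_cell n _) (pairwise_disjoint_cell n)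
      hu.integrableOn, iUnion_cell, setIntegral_univ]
  rw [key f hf, key g hg]
  refine tsum_congr fun c => ?_
  by_cases hc : Valid (extendHistory c) n
  · exact h _ hc
  · rw [setIntegral_measure_zero _ (hT.measure_cell_of_not_valid hc),
      setIntegral_measure_zero _ (hT.measure_cell_of_not_valid hc)]

end Histories

/-! ### Variables determined by the history -/

section Adapted

variable {Ω S β γ : Type*} [MeasurableSpace Ω] [MeasurableSpace S] [MeasurableSpace β]
  [MeasurableSpace γ] {T : ℕ → Ω → BinTree} {η : Node → Ω → S} {n : ℕ}

/-- Given the trees up to time `n`, the variable `Z` is a function of the labels of the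
internal nodes of the tree at time `n`. -/
def AdaptedAt (T : ℕ → Ω → BinTree) (η : Node → Ω → S) (n : ℕ) (Z : Ω → β) : Prop :=
  ∀ h, Valid h n → ∃ g : (Node → S) → β, Measurable g ∧ DependsOn g (h n).internal ∧
    ∀ ω ∈ cell T n h, Z ω = g fun v => η v ω

lemma AdaptedAt.comp {Z : Ω → β} (hZ : AdaptedAt T η n Z) {φ : β → γ} (hφ : Measurable φ) :
    AdaptedAt T η n fun ω => φ (Z ω) := fun h hv => by
  obtain ⟨g, hg1, hg2, hg3⟩ := hZ h hv
  exact ⟨fun x => φ (g x), hφ.comp hg1, fun x y hxy => congrArg φ (hg2 hxy),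
    fun ω hω => congrArg φ (hg3 ω hω)⟩

lemma AdaptedAt.prodMk {Z : Ω → β} {W : Ω → γ} (hZ : AdaptedAt T η n Z) (hW : AdaptedAt T η n W) :
    AdaptedAt T η n fun ω => (Z ω, W ω) := fun h hv => by
  obtain ⟨g, hg1, hg2, hg3⟩ := hZ h hv
  obtain ⟨k, hk1, hk2, hk3⟩ := hW h hv
  exact ⟨fun x => (g x, k x), hg1.prodMk hk1, fun x y hxy => by simp only [hg2 hxy, hk2 hxy],
    fun ω hω => by simp only [hg3 ω hω, hk3 ω hω]⟩

lemma AdaptedAt.const (c : β) : AdaptedAt T η n fun _ => c := fun _ _ =>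
  ⟨fun _ => c, measurable_const, fun _ _ _ => rfl, fun _ _ => rfl⟩

/-- Internal nodes stay internal and cells shrink, so the same function of the labels serves at the
later time. -/
lemma AdaptedAt.mono {Z : Ω → β} (hZ : AdaptedAt T η n Z) {m : ℕ} (hnm : n ≤ m) :
    AdaptedAt T η m Z := by
  induction hnm with
  | refl => exact hZ
  | step _ ih =>
    intro h hv
    obtain ⟨g, hg1, hg2, hg3⟩ := ih h (hv.mono (Nat.le_succ _))
    exact ⟨g, hg1, fun x y hxy => hg2 fun v hx => hxy v (hv.internal_subset hx),
      fun ω hω => hg3 ω (cell_subset (Nat.le_succ _) h hω)⟩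

lemma AdaptedAt.mul {Z W : Ω → ℂ} (hZ : AdaptedAt T η n Z) (hW : AdaptedAt T η n W) :
    AdaptedAt T η n fun ω => Z ω * W ω :=
  (hZ.prodMk hW).comp (measurable_fst.mul measurable_snd)

lemma AdaptedAt.indicator {Z : Ω → ℂ} (hZ : AdaptedAt T η n Z) {A : Set Ω}
    (hA : AdaptedAt T η n fun ω => ω ∈ A) : AdaptedAt T η n (A.indicator Z) := by
  classical
  have := (hA.prodMk hZ).comp (φ := fun p : Prop × ℂ => if p.1 then p.2 else 0)
    (Measurable.ite (measurable_fst (measurableSet_setOfPred.2 measurable_id)) measurable_snd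
      measurable_const)
  refine (funext fun ω => ?_ : A.indicator Z = _) ▸ this
  simp [Set.indicator_apply]

/-- The filtration generated by the trees and the labels of their internal nodes. -/
def history (T : ℕ → Ω → BinTree) (η : Node → Ω → S) : Filtration ℕ ‹MeasurableSpace Ω› where
  seq n :=
    { MeasurableSet' := fun A => MeasurableSet A ∧ AdaptedAt T η n fun ω => ω ∈ A
      measurableSet_empty := ⟨MeasurableSet.empty, AdaptedAt.const False⟩
      measurableSet_compl := fun _ hA => ⟨hA.1.compl, hA.2.comp (φ := Not) measurable_from_top⟩
      measurableSet_iUnion := fun A hA => ⟨MeasurableSet.iUnion fun i => (hA i).1, fun h hv => by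
        choose g hg1 hg2 hg3 using fun i => (hA i).2 h hv
        refine ⟨fun x => ∃ i, g i x, Measurable.exists hg1, fun x y hxy => ?_, fun ω hω => ?_⟩
        · simp only [hg2 _ hxy]
        · simp only [Set.mem_iUnion, hg3 _ ω hω]⟩ }
  mono' _ _ hnm _ hA := ⟨hA.1, hA.2.mono hnm⟩
  le' _ _ hA := hA.1

lemma AdaptedAt.measurable_history {Z : Ω → β} (hZ : AdaptedAt T η n Z) (hm : Measurable Z) :
    Measurable[history T η n] Z := fun s hs =>
  ⟨hm hs, hZ.comp (φ := fun b => b ∈ s) (measurableSet_setOfPred.1 hs)⟩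

end Adapted

/-! ### The labelled process and averaging over one step -/

section Model

variable {E : Type*} [NormedAddCommGroup E] [InnerProductSpace ℝ E] [MeasurableSpace E]
  [BorelSpace E] [SecondCountableTopology E] {Ω : Type*} [MeasurableSpace Ω]

/-- A random binary search tree process with independent identically distributed labels. -/
structure IsLabelledBST (P : Measure Ω) (T : ℕ → Ω → BinTree) (η : Node → Ω → E × E)
    (ν : Measure (E × E)) : Prop where
  bst : IsRandomBST P T
  measurable : ∀ v, Measurable (η v)
  law : ∀ v, P.map (η v) = ν
  iIndep : iIndepFun η P
  indep : IndepFun (fun ω n => T n ω) (fun ω v => η v ω) P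

variable {P : Measure Ω} [IsProbabilityMeasure P] {T : ℕ → Ω → BinTree} {η : Node → Ω → E × E}
  {ν : Measure (E × E)}

lemma IsLabelledBST.measurable_labels (hM : IsLabelledBST P T η ν) :
    Measurable fun ω v => η v ω := measurable_pi_lambda _ hM.measurable

/-- The label of v is independent of the finite family of labels on S. To view g as a function of
that family, the missing labels are filled in with 0, which does not change its value. -/
lemma IsLabelledBST.integral_mul_of_notMem (hM : IsLabelledBST P T η ν) {S : Finset Node} {v : Node}
    (hv : v ∉ S) {g : (Node → E × E) → ℂ} (hg : Measurable g) (hgS : DependsOn g S)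
    {f : E × E → ℂ} (hf : Measurable f) :
    ∫ ω, g (fun u => η u ω) * f (η v ω) ∂P = (∫ ω, g (fun u => η u ω) ∂P) * ∫ x, f x ∂ν := by
  classical
  have hind := hM.iIndep.indepFun_finset S {v} (by simpa using hv) hM.measurable
  let ext : (S → E × E) → Node → E × E := fun x u => if hu : u ∈ S then x ⟨u, hu⟩ else 0
  have hext : Measurable ext := by
    refine measurable_pi_lambda _ fun u => ?_
    by_cases hu : u ∈ S
    · simp only [ext, dif_pos hu]; exact measurable_pi_apply _
    · simp only [ext, dif_neg hu]; exact measurable_const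
  have h2 := hind.comp (φ := fun x => g (ext x)) (hg.comp hext)
    (ψ := fun x : ({v} : Finset Node) → E × E => f (x ⟨v, Finset.mem_singleton_self v⟩))
    (hf.comp (measurable_pi_apply _))
  have h3 : ∀ ω, g (ext fun i : S => η i ω) = g fun u => η u ω := fun ω =>
    hgS fun u hu => by
      have hu' : u ∈ S := hu
      simp [ext, hu']
  simp only [Function.comp_def, h3] at h2
  rw [h2.integral_fun_mul_eq_mul_integral (hg.comp hM.measurable_labels).aestronglyMeasurable
    (hf.comp (hM.measurable v)).aestronglyMeasurable, ← hM.law v,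
    integral_map (hM.measurable v).aemeasurable hf.aestronglyMeasurable]

lemma IsLabelledBST.setIntegral_labels (hM : IsLabelledBST P T η ν) {A : Set (ℕ → BinTree)}
    (hA : MeasurableSet A) {g : (Node → E × E) → ℂ} (hg : Measurable g) :
    ∫ ω in {ω | (fun n => T n ω) ∈ A}, g (fun u => η u ω) ∂P =
      P.real {ω | (fun n => T n ω) ∈ A} * ∫ ω, g (fun u => η u ω) ∂P := by
  have hm : Measurable fun ω n => T n ω := measurable_pi_lambda _ hM.bst.measurable
  have := Indep.setIntegral_eq_smul (P := P) (m := MeasurableSpace.comap (fun ω n => T n ω) inferInstance)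
    (A := {ω | (fun n => T n ω) ∈ A}) (f := g) hm.comap_le hM.indep
    hM.measurable_labels.aemeasurable ⟨A, hA, rfl⟩ hg.aestronglyMeasurable
  rw [this, Complex.real_smul]

/-- The sum of a character over the external nodes at time `n`. -/
noncomputable def extSum (T : ℕ → Ω → BinTree) (η : Node → Ω → E × E) (t : E) (n : ℕ) (ω : Ω) : ℂ :=
  charSum t (T n ω).external fun v => η v ω

/-- The sum of a character over the internal nodes at time `n`. -/
noncomputable def intSum (T : ℕ → Ω → BinTree) (η : Node → Ω → E × E) (t : E) (n : ℕ) (ω : Ω) : ℂ :=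
  charSum t (T n ω).internal fun v => η v ω

/-- The value `phase t (walk v) * f (η v)` at the node `v` split at time `n`. -/
noncomputable def splitTerm (T : ℕ → Ω → BinTree) (η : Node → Ω → E × E) (t : E) (f : E × E → ℂ)
    (n : ℕ) (ω : Ω) : ℂ :=
  increment t f (T n ω) (T (n + 1) ω) fun v => η v ω

lemma IsLabelledBST.measurable_extSum (hM : IsLabelledBST P T η ν) (t : E) (n : ℕ) :
    Measurable (extSum T η t n) :=
  measurable_apply_countable (hM.bst.measurable n)
    (Ψ := fun τ ω => charSum t τ.external fun v => η v ω)
    fun τ => (measurable_charSum t τ.external).comp hM.measurable_labels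

lemma IsLabelledBST.measurable_intSum (hM : IsLabelledBST P T η ν) (t : E) (n : ℕ) :
    Measurable (intSum T η t n) :=
  measurable_apply_countable (hM.bst.measurable n)
    (Ψ := fun τ ω => charSum t τ.internal fun v => η v ω)
    fun τ => (measurable_charSum t τ.internal).comp hM.measurable_labels

lemma IsLabelledBST.measurable_splitTerm (hM : IsLabelledBST P T η ν) (t : E) {f : E × E → ℂ}
    (hf : Measurable f) (n : ℕ) : Measurable (splitTerm T η t f n) :=
  measurable_apply_countable (hM.bst.measurable n)
    (Ψ := fun τ ω => increment t f τ (T (n + 1) ω) fun v => η v ω)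
    fun τ => measurable_apply_countable (hM.bst.measurable (n + 1))
      (Ψ := fun τ' ω => increment t f τ τ' fun v => η v ω)
      fun τ' => (measurable_increment t hf τ τ').comp hM.measurable_labels

lemma adaptedAt_charSum {F : BinTree → Finset Node} (hF : ∀ τ, F τ ⊆ τ.nodes) (t : E) (n : ℕ) :
    AdaptedAt T η n fun ω => charSum t (F (T n ω)) fun v => η v ω := fun h hv =>
  ⟨charSum t (F (h n)), measurable_charSum t _, fun x y hxy => Finset.sum_congr rfl fun v hv' => by
    rw [walk_congr hv.proper hxy (hF _ hv')], fun ω hω => by simp only [hω n le_rfl]⟩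

lemma adaptedAt_extSum (t : E) (n : ℕ) : AdaptedAt T η n (extSum T η t n) :=
  adaptedAt_charSum (F := BinTree.external) (fun _ => Finset.subset_union_right) t n

lemma adaptedAt_intSum (t : E) (n : ℕ) : AdaptedAt T η n (intSum T η t n) :=
  adaptedAt_charSum (F := BinTree.internal) (fun _ => Finset.subset_union_left) t n

lemma IsLabelledBST.ae_split (hM : IsLabelledBST P T η ν) : ∀ᵐ ω ∂P, ∀ n, (T n ω).Proper ∧
    (T n ω).internal.card = n ∧ (T n ω).external.card = n + 1 ∧
    ∃ v ∈ (T n ω).external, T (n + 1) ω = (T n ω).split v := by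
  filter_upwards [hM.bst.ae_valid] with ω hω n
  exact ⟨(hω n).proper, (hω n).card_internal, (hω n).card_external, (hω (n + 1)).2 n n.lt_succ_self⟩

lemma IsLabelledBST.ae_norm_extSum_le (hM : IsLabelledBST P T η ν) (t : E) :
    ∀ᵐ ω ∂P, ∀ n, ‖extSum T η t n ω‖ ≤ n + 1 := by
  filter_upwards [hM.ae_split] with ω hω n
  refine (norm_charSum_le t _ _).trans_eq ?_
  rw [(hω n).2.2.1]
  push_cast
  rfl

lemma IsLabelledBST.ae_extSum_zero_left (hM : IsLabelledBST P T η ν) :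
    ∀ᵐ ω ∂P, ∀ n, extSum T η 0 n ω = n + 1 := by
  filter_upwards [hM.ae_split] with ω hω n
  rw [extSum, charSum_zero_left, (hω n).2.2.1]
  push_cast
  rfl

lemma IsLabelledBST.ae_extSum_zero (hM : IsLabelledBST P T η ν) (t : E) :
    ∀ᵐ ω ∂P, extSum T η t 0 ω = 1 := by
  filter_upwards [hM.bst.zero] with ω hω
  rw [extSum, hω]
  simp [charSum, BinTree.start, walk]

lemma IsLabelledBST.ae_intSum_zero (hM : IsLabelledBST P T η ν) (t : E) :
    ∀ᵐ ω ∂P, intSum T η t 0 ω = 0 := by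
  filter_upwards [hM.bst.zero] with ω hω
  rw [intSum, hω]
  simp [charSum, BinTree.start]

lemma IsLabelledBST.ae_extSum_succ (hM : IsLabelledBST P T η ν) (t : E) : ∀ᵐ ω ∂P, ∀ n,
    extSum T η t (n + 1) ω = extSum T η t n ω + splitTerm T η t (offspring t) n ω := by
  filter_upwards [hM.ae_split] with ω hω n
  obtain ⟨hp, -, -, v, hv1, hv2⟩ := hω n
  rw [extSum, splitTerm, hv2, charSum_external_split t hp hv1, increment_split t _ hp hv1]
  rfl

lemma IsLabelledBST.ae_norm_splitTerm_le (hM : IsLabelledBST P T η ν) (t : E) {f : E × E → ℂ}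
    {C : ℝ} (hf : ∀ x, ‖f x‖ ≤ C) : ∀ᵐ ω ∂P, ∀ n, ‖splitTerm T η t f n ω‖ ≤ C := by
  filter_upwards [hM.ae_split] with ω hω n
  obtain ⟨hp, -, -, v, hv1, hv2⟩ := hω n
  rw [splitTerm, hv2, increment_split t _ hp hv1, norm_mul, norm_phase, one_mul]
  exact hf _

/-- Characters have modulus 1, so the square is a split term at the trivial character 0, and the
averaging formula also yields second moments. -/
lemma IsLabelledBST.ae_normSq_splitTerm (hM : IsLabelledBST P T η ν) (t : E) (f : E × E → ℂ) :
    ∀ᵐ ω ∂P, ∀ n, ((‖splitTerm T η t f n ω‖ ^ 2 : ℝ) : ℂ) =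
      splitTerm T η 0 (fun x => ((‖f x‖ ^ 2 : ℝ) : ℂ)) n ω := by
  filter_upwards [hM.ae_split] with ω hω n
  obtain ⟨hp, -, -, v, hv1, hv2⟩ := hω n
  rw [splitTerm, splitTerm, hv2, increment_split t _ hp hv1, increment_split 0 _ hp hv1, norm_mul,
    norm_phase, one_mul, phase_zero_left, one_mul]

lemma IsLabelledBST.measureReal_step (hM : IsLabelledBST P T η ν) {n : ℕ} {h : ℕ → BinTree}
    (hv : Valid h n) {v : Node} (hv' : v ∈ (h n).external) :
    P.real (cell T n h ∩ {ω | T (n + 1) ω = (h n).split v}) = P.real (cell T n h) / (n + 1) := by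
  have := hM.bst.step n h v hv'
  rw [hv.card_external] at this
  rw [measureReal_def, measureReal_def]
  change (P {ω | (∀ k ≤ n, T k ω = h k) ∧ T (n + 1) ω = (h n).split v}).toReal = _
  rw [this, ENNReal.toReal_div, ENNReal.toReal_natCast]
  push_cast
  rfl

/-- Averaging over the node split at time `n` and its label, given the history. -/
lemma IsLabelledBST.integral_mul_splitTerm (hM : IsLabelledBST P T η ν) (t : E) {n : ℕ} {Z : Ω → ℂ}
    (hZm : Measurable Z) (hZ : AdaptedAt T η n Z) {C : ℝ} (hZb : ∀ᵐ ω ∂P, ‖Z ω‖ ≤ C)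
    {f : E × E → ℂ} (hf : Measurable f) {K : ℝ} (hfb : ∀ x, ‖f x‖ ≤ K) :
    ∫ ω, Z ω * splitTerm T η t f n ω ∂P =
      (∫ ω, Z ω * extSum T η t n ω ∂P) * (∫ x, f x ∂ν) / (n + 1) := by
  classical
  have hK : 0 ≤ K := (norm_nonneg _).trans (hfb 0)
  have hphase : ∀ v, Measurable fun ω => phase t (walk (fun u => η u ω) v) := fun v =>
    (measurable_phase_walk t v).comp hM.measurable_labels
  have hbd : ∀ v, ∀ᵐ ω ∂P, ‖Z ω * phase t (walk (fun u => η u ω) v)‖ ≤ C := fun v =>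
    hZb.mono fun ω hω => by rwa [norm_mul, norm_phase, mul_one]
  have hi1 : ∀ v, Integrable (fun ω => Z ω * phase t (walk (fun u => η u ω) v)) P := fun v =>
    Integrable.of_bound (hZm.mul (hphase v)).aestronglyMeasurable C (hbd v)
  have hi2 : ∀ v, Integrable (fun ω => Z ω * phase t (walk (fun u => η u ω) v) * f (η v ω)) P :=
    fun v => Integrable.of_bound
      ((hZm.mul (hphase v)).mul (hf.comp (hM.measurable v))).aestronglyMeasurable (C * K)
      ((hbd v).mono fun ω hω => by
        rw [norm_mul]
        exact mul_le_mul hω (hfb _) (norm_nonneg _) ((norm_nonneg _).trans hω))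
  have hi3 : Integrable (fun ω => Z ω * splitTerm T η t f n ω) P := by
    refine Integrable.of_bound (hZm.mul (hM.measurable_splitTerm t hf n)).aestronglyMeasurable
      (C * K) ?_
    filter_upwards [hZb, hM.ae_norm_splitTerm_le t hfb] with ω h1 h2
    rw [norm_mul]
    exact mul_le_mul h1 (h2 n) (norm_nonneg _) ((norm_nonneg _).trans h1)
  have hi4 : Integrable (fun ω => Z ω * extSum T η t n ω) P := by
    refine Integrable.of_bound (hZm.mul (hM.measurable_extSum t n)).aestronglyMeasurable
      (C * (n + 1)) ?_
    filter_upwards [hZb, hM.ae_norm_extSum_le t] with ω h1 h2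
    rw [norm_mul]
    exact mul_le_mul h1 (h2 n) (norm_nonneg _) ((norm_nonneg _).trans h1)
  rw [mul_div_assoc, ← integral_mul_const]
  refine hM.bst.integral_eq_of_cells n hi3 (hi4.mul_const _) fun h hv => ?_
  obtain ⟨g, hg1, hg2, hg3⟩ := hZ h hv
  have hcell := hM.bst.measurableSet_cell n h
  have hstep : ∀ v, MeasurableSet {ω | T (n + 1) ω = (h n).split v} := fun v =>
    hM.bst.measurable (n + 1) (measurableSet_singleton ((h n).split v))
  have hA : MeasurableSet {τ : ℕ → BinTree | ∀ k ≤ n, τ k = h k} := by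
    have : {τ : ℕ → BinTree | ∀ k ≤ n, τ k = h k} =
        ⋂ k, ⋂ (_ : k ≤ n), (fun τ => τ k) ⁻¹' {h k} := by
      ext τ; simp
    rw [this]
    exact MeasurableSet.iInter fun k => MeasurableSet.iInter fun _ =>
      measurable_pi_apply k (measurableSet_singleton _)
  have hA' : ∀ v, MeasurableSet
      ({τ : ℕ → BinTree | ∀ k ≤ n, τ k = h k} ∩ {τ | τ (n + 1) = (h n).split v}) := fun v =>
    hA.inter ((measurable_pi_apply (X := fun _ : ℕ => BinTree) (n + 1))
      (measurableSet_singleton ((h n).split v)))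
  have hgm : ∀ v, Measurable fun x : Node → E × E => g x * phase t (walk x v) := fun v =>
    hg1.mul (measurable_phase_walk t v)
  calc ∫ ω in cell T n h, Z ω * splitTerm T η t f n ω ∂P
      = ∫ ω in cell T n h, ∑ v ∈ (h n).external, {ω | T (n + 1) ω = (h n).split v}.indicator
          (fun ω => Z ω * phase t (walk (fun u => η u ω) v) * f (η v ω)) ω ∂P := by
        refine setIntegral_congr_fun hcell fun ω hω => ?_
        simp only [splitTerm, increment, hω n le_rfl, Finset.mul_sum, Set.indicator_apply,
          Set.mem_ofPred_eq, mul_ite, mul_zero, mul_assoc]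
    _ = ∑ v ∈ (h n).external, ∫ ω in cell T n h ∩ {ω | T (n + 1) ω = (h n).split v},
          Z ω * phase t (walk (fun u => η u ω) v) * f (η v ω) ∂P := by
        rw [integral_finsetSum _ fun v _ => ((hi2 v).indicator (hstep v)).integrableOn]
        refine Finset.sum_congr rfl fun v _ => ?_
        rw [setIntegral_indicator (hstep v)]
    _ = ∑ v ∈ (h n).external, ∫ ω in cell T n h ∩ {ω | T (n + 1) ω = (h n).split v},
          g (fun u => η u ω) * phase t (walk (fun u => η u ω) v) * f (η v ω) ∂P := by
        refine Finset.sum_congr rfl fun v _ => setIntegral_congr_fun (hcell.inter (hstep v))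
          fun ω hω => ?_
        simp only [hg3 ω hω.1]
    -- Both independences act here. The trees are independent of the labels, so the event factors
    -- out with its probability; and v is not internal, so its label is independent of g and of the
    -- position of v.
    _ = ∑ v ∈ (h n).external, (P.real (cell T n h) / (n + 1) : ℝ) *
          ((∫ ω, g (fun u => η u ω) * phase t (walk (fun u => η u ω) v) ∂P) * ∫ x, f x ∂ν) := by
        refine Finset.sum_congr rfl fun v hv' => ?_
        rw [← hM.measureReal_step hv hv',
          ← hM.integral_mul_of_notMem (hv.proper.notMem_internal hv') (hgm v) ?_ hf]
        · exact hM.setIntegral_labels (hA' v)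
            (g := fun x => g x * phase t (walk x v) * f (x v))
            ((hgm v).mul (hf.comp (measurable_pi_apply v)))
        · intro x y hxy
          simp only [hg2 hxy, walk_congr hv.proper hxy (Finset.mem_union_right _ hv')]
    -- The probability of the cell is reabsorbed by the same independence, now without the label of
    -- v and without fixing the split.
    _ = (∑ v ∈ (h n).external, ∫ ω in cell T n h,
          g (fun u => η u ω) * phase t (walk (fun u => η u ω) v) ∂P) * ((∫ x, f x ∂ν) / (n + 1)) := by
        rw [Finset.sum_mul]
        refine Finset.sum_congr rfl fun v _ => ?_
        have := hM.setIntegral_labels hA (hgm v)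
        change ∫ ω in cell T n h, _ ∂P = ((P.real (cell T n h) : ℝ) : ℂ) * _ at this
        rw [this]
        push_cast
        ring
    _ = (∑ v ∈ (h n).external, ∫ ω in cell T n h,
          Z ω * phase t (walk (fun u => η u ω) v) ∂P) * ((∫ x, f x ∂ν) / (n + 1)) := by
        congr 1
        refine Finset.sum_congr rfl fun v _ => setIntegral_congr_fun hcell fun ω hω => ?_
        simp only [hg3 ω hω]
    _ = ∫ ω in cell T n h, Z ω * extSum T η t n ω * ((∫ x, f x ∂ν) / (n + 1)) ∂P := by
        rw [integral_mul_const, ← integral_finsetSum _ fun v _ => (hi1 v).integrableOn]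
        congr 1
        refine setIntegral_congr_fun hcell fun ω hω => ?_
        simp only [extSum, charSum, hω n le_rfl, Finset.mul_sum]

end Model

open ComplexConjugate

/-! ### Orthogonal increments and the maximal inequality -/

section Maximal

variable {Ω : Type*} [mΩ : MeasurableSpace Ω] {P : Measure Ω} [IsProbabilityMeasure P]

lemma integrable_of_ae_bound {β : Type*} [NormedAddCommGroup β] {f : Ω → β}
    (hf : AEStronglyMeasurable f P) (hb : ∃ C, ∀ᵐ ω ∂P, ‖f ω‖ ≤ C) : Integrable f P :=
  hb.elim fun C hC => Integrable.of_bound hf C hC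

lemma integrable_norm_sq {f : Ω → ℂ} (hf : Measurable f) (hb : ∃ C, ∀ᵐ ω ∂P, ‖f ω‖ ≤ C) :
    Integrable (fun ω => ‖f ω‖ ^ 2) P := by
  obtain ⟨C, hC⟩ := hb
  refine Integrable.of_bound (hf.norm.pow_const 2).aestronglyMeasurable (C ^ 2)
    (hC.mono fun ω hω => ?_)
  rw [Real.norm_of_nonneg (by positivity)]
  exact pow_le_pow_left₀ (norm_nonneg _) hω 2

lemma norm_add_sq_complex (a b : ℂ) :
    ‖a + b‖ ^ 2 = ‖a‖ ^ 2 + ‖b‖ ^ 2 + 2 * (conj a * b).re := by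
  rw [← Complex.normSq_eq_norm_sq, ← Complex.normSq_eq_norm_sq, ← Complex.normSq_eq_norm_sq,
    Complex.normSq_apply, Complex.normSq_apply, Complex.normSq_apply]
  simp
  ring

lemma setIntegral_norm_add_sq {f g : Ω → ℂ} (hf : Measurable f) (hg : Measurable g)
    (hfb : ∃ C, ∀ᵐ ω ∂P, ‖f ω‖ ≤ C) (hgb : ∃ C, ∀ᵐ ω ∂P, ‖g ω‖ ≤ C) (A : Set Ω) :
    ∫ ω in A, ‖f ω + g ω‖ ^ 2 ∂P = (∫ ω in A, ‖f ω‖ ^ 2 ∂P) + (∫ ω in A, ‖g ω‖ ^ 2 ∂P) +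
      2 * (∫ ω in A, conj (f ω) * g ω ∂P).re := by
  have h1 := (integrable_norm_sq hf hfb).integrableOn (s := A)
  have h2 := (integrable_norm_sq hg hgb).integrableOn (s := A)
  have h3 : Integrable (fun ω => conj (f ω) * g ω) P := by
    refine integrable_of_ae_bound
      ((Complex.continuous_conj.measurable.comp hf).mul hg).aestronglyMeasurable ?_
    obtain ⟨C, hC⟩ := hfb
    obtain ⟨D, hD⟩ := hgb
    refine ⟨C * D, ?_⟩
    filter_upwards [hC, hD] with ω h4 h5
    rw [norm_mul, RCLike.norm_conj]
    exact mul_le_mul h4 h5 (norm_nonneg _) ((norm_nonneg _).trans h4)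
  have h4 := (h3.integrableOn (s := A))
  have h5 : ∫ ω in A, (conj (f ω) * g ω).re ∂P = (∫ ω in A, conj (f ω) * g ω ∂P).re := by
    have := integral_re (𝕜 := ℂ) h4
    simpa only [RCLike.re_eq_complex_re] using this
  have h6 : Integrable (fun ω => 2 * (conj (f ω) * g ω).re) (P.restrict A) := by
    have := h4.re
    simp only [RCLike.re_eq_complex_re] at this
    exact this.const_mul 2
  simp_rw [norm_add_sq_complex]
  have h7 := integral_add (h1.add h2) h6
  simp only [Pi.add_apply] at h7
  rw [h7, integral_add h1 h2, integral_const_mul, h5]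

variable {𝒢 : Filtration ℕ mΩ} {N : ℕ → Ω → ℂ}

/-- Pythagoras on A: the hypothesis `horth` kills the cross term. This weak form of the martingale
property is all that is used of it, and it makes ‖N n‖² a submartingale. -/
lemma setIntegral_norm_sq_succ (hadp : ∀ n, Measurable[𝒢 n] (N n))
    (hb : ∀ n, ∃ C, ∀ᵐ ω ∂P, ‖N n ω‖ ≤ C)
    (horth : ∀ n A, MeasurableSet[𝒢 n] A →
      ∫ ω in A, conj (N n ω) * (N (n + 1) ω - N n ω) ∂P = 0) (n : ℕ) {A : Set Ω}
    (hA : MeasurableSet[𝒢 n] A) : ∫ ω in A, ‖N (n + 1) ω‖ ^ 2 ∂P =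
      (∫ ω in A, ‖N n ω‖ ^ 2 ∂P) + ∫ ω in A, ‖N (n + 1) ω - N n ω‖ ^ 2 ∂P := by
  have hm : ∀ n, Measurable (N n) := fun n => (hadp n).mono (𝒢.le n) le_rfl
  have hd : ∃ C, ∀ᵐ ω ∂P, ‖N (n + 1) ω - N n ω‖ ≤ C := by
    obtain ⟨C, hC⟩ := hb n
    obtain ⟨D, hD⟩ := hb (n + 1)
    refine ⟨D + C, ?_⟩
    filter_upwards [hC, hD] with ω h4 h5
    exact (norm_sub_le _ _).trans (add_le_add h5 h4)
  have := setIntegral_norm_add_sq (hm n) ((hm (n + 1)).sub (hm n)) (hb n) hd A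
  simp only [Pi.sub_apply, add_sub_cancel] at this
  rw [this, horth n A hA]
  simp

/-- Maximal inequality for bounded complex martingales with bounded second moments. -/
lemma measure_exists_le_norm (hadp : ∀ n, Measurable[𝒢 n] (N n))
    (hb : ∀ n, ∃ C, ∀ᵐ ω ∂P, ‖N n ω‖ ≤ C)
    (horth : ∀ n A, MeasurableSet[𝒢 n] A →
      ∫ ω in A, conj (N n ω) * (N (n + 1) ω - N n ω) ∂P = 0)
    {K : ℝ} (hK : ∀ n, ∫ ω, ‖N n ω‖ ^ 2 ∂P ≤ K) {ε : ℝ} (hε : 0 < ε) :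
    P {ω | ∃ n, ε ≤ ‖N n ω‖} ≤ ENNReal.ofReal (K / ε ^ 2) := by
  have hm : ∀ n, Measurable (N n) := fun n => (hadp n).mono (𝒢.le n) le_rfl
  have hi : ∀ n, Integrable (fun ω => ‖N n ω‖ ^ 2) P := fun n => integrable_norm_sq (hm n) (hb n)
  have hsub : Submartingale (fun n ω => ‖N n ω‖ ^ 2) 𝒢 P := by
    refine submartingale_of_setIntegral_le_succ (fun n => ?_) hi fun n A hA => ?_
    · exact ((continuous_norm.pow 2).measurable.comp (hadp n)).stronglyMeasurable
    · rw [setIntegral_norm_sq_succ hadp hb horth n hA]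
      have : 0 ≤ ∫ ω in A, ‖N (n + 1) ω - N n ω‖ ^ 2 ∂P :=
        integral_nonneg fun _ => by positivity
      linarith
  have key : ∀ n, P {ω | ∃ k ≤ n, ε ≤ ‖N k ω‖} ≤ ENNReal.ofReal (K / ε ^ 2) := by
    intro n
    obtain ⟨r, hr⟩ : ∃ r : NNReal, (r : ℝ) = ε ^ 2 := ⟨⟨ε ^ 2, by positivity⟩, rfl⟩
    have hset : {ω | (r : ℝ) ≤ (Finset.range (n + 1)).sup'
        Finset.nonempty_range_add_one fun k => ‖N k ω‖ ^ 2} = {ω | ∃ k ≤ n, ε ≤ ‖N k ω‖} := by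
      ext ω
      simp only [Set.mem_ofPred_eq, Finset.le_sup'_iff, Finset.mem_range, Nat.lt_succ_iff, hr]
      refine exists_congr fun k => and_congr_right fun _ => ?_
      exact pow_le_pow_iff_left₀ hε.le (norm_nonneg _) two_ne_zero
    have h : r * P {ω | ∃ k ≤ n, ε ≤ ‖N k ω‖} ≤
        ENNReal.ofReal (∫ ω in {ω | ∃ k ≤ n, ε ≤ ‖N k ω‖}, ‖N n ω‖ ^ 2 ∂P) := by
      rw [← hset]
      exact maximal_ineq hsub (fun _ _ => by positivity) n
    have h2 : ENNReal.ofReal (∫ ω in {ω | ∃ k ≤ n, ε ≤ ‖N k ω‖}, ‖N n ω‖ ^ 2 ∂P) ≤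
        ENNReal.ofReal K := by
      refine ENNReal.ofReal_le_ofReal ((setIntegral_le_integral (hi n) ?_).trans (hK n))
      exact ae_of_all _ fun _ => by positivity
    have h3 : (r : ENNReal) = ENNReal.ofReal (ε ^ 2) := by
      rw [← hr, ENNReal.ofReal_coe_nnreal]
    rw [ENNReal.ofReal_div_of_pos (by positivity), ENNReal.le_div_iff_mul_le
      (Or.inl (by simpa using hε.ne')) (Or.inl ENNReal.ofReal_ne_top), mul_comm, ← h3]
    exact h.trans h2
  have hU : {ω | ∃ n, ε ≤ ‖N n ω‖} = ⋃ n, {ω | ∃ k ≤ n, ε ≤ ‖N k ω‖} := by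
    ext ω
    simp only [Set.mem_ofPred_eq, Set.mem_iUnion]
    exact ⟨fun ⟨n, hn⟩ => ⟨n, n, le_rfl, hn⟩, fun ⟨_, k, _, hk⟩ => ⟨k, hk⟩⟩
  -- Doob's inequality covers finite time horizons; continuity from below extends it to all times,
  -- the bound being uniform.
  have hmono : Monotone fun n => {ω | ∃ k ≤ n, ε ≤ ‖N k ω‖} := by
    rintro a b hab ω ⟨k, hk1, hk2⟩
    exact ⟨k, hk1.trans hab, hk2⟩
  rw [hU, hmono.measure_iUnion]
  exact iSup_le key

end Maximal

/-! ### The two martingales -/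

section Martingales

variable {E : Type*} [NormedAddCommGroup E] [InnerProductSpace ℝ E] [MeasurableSpace E]
  [BorelSpace E] [SecondCountableTopology E] {Ω : Type*} [MeasurableSpace Ω]
  {P : Measure Ω} [IsProbabilityMeasure P] {T : ℕ → Ω → BinTree} {η : Node → Ω → E × E}
  {ν : Measure (E × E)} [IsProbabilityMeasure ν]

/-- The indicator of A times the conjugate of N n is determined by the history, so it can serve as
the weight Z in `integral_mul_splitTerm`. The factor d n accommodates both normalisations: 1/growth
for the external sums, 1/(n+1) for the comparison. -/
lemma IsLabelledBST.setIntegral_conj_mul_eq_zero (hM : IsLabelledBST P T η ν) (t : E)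
    {N : ℕ → Ω → ℂ} (hNm : ∀ n, Measurable (N n)) (hN : ∀ n, AdaptedAt T η n (N n))
    (hNb : ∀ n, ∃ C, ∀ᵐ ω ∂P, ‖N n ω‖ ≤ C) {f : E × E → ℂ} (hf : Measurable f) {K : ℝ}
    (hfb : ∀ x, ‖f x‖ ≤ K) (d : ℕ → ℂ)
    (hinc : ∀ᵐ ω ∂P, ∀ n, N (n + 1) ω - N n ω =
      (splitTerm T η t f n ω - extSum T η t n ω * (∫ x, f x ∂ν) / (n + 1)) * d n)
    (n : ℕ) {A : Set Ω} (hA : MeasurableSet[history T η n] A) :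
    ∫ ω in A, conj (N n ω) * (N (n + 1) ω - N n ω) ∂P = 0 := by
  obtain ⟨C, hC⟩ := hNb n
  set Z : Ω → ℂ := A.indicator fun ω => conj (N n ω) with hZ
  have hZm : Measurable Z := (Complex.continuous_conj.measurable.comp (hNm n)).indicator hA.1
  have hZa : AdaptedAt T η n Z :=
    ((hN n).comp Complex.continuous_conj.measurable).indicator hA.2
  have hZb : ∀ᵐ ω ∂P, ‖Z ω‖ ≤ C := hC.mono fun ω hω => by
    refine (norm_indicator_le_norm_self _ _).trans ?_
    rwa [RCLike.norm_conj]
  have hi1 : Integrable (fun ω => Z ω * splitTerm T η t f n ω) P := by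
    refine Integrable.of_bound (hZm.mul (hM.measurable_splitTerm t hf n)).aestronglyMeasurable
      (C * K) ?_
    filter_upwards [hZb, hM.ae_norm_splitTerm_le t hfb] with ω h1 h2
    rw [norm_mul]
    exact mul_le_mul h1 (h2 n) (norm_nonneg _) ((norm_nonneg _).trans h1)
  have hi2 : Integrable (fun ω => Z ω * extSum T η t n ω) P := by
    refine Integrable.of_bound (hZm.mul (hM.measurable_extSum t n)).aestronglyMeasurable
      (C * (n + 1)) ?_
    filter_upwards [hZb, hM.ae_norm_extSum_le t] with ω h1 h2
    rw [norm_mul]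
    exact mul_le_mul h1 (h2 n) (norm_nonneg _) ((norm_nonneg _).trans h1)
  rw [← integral_indicator hA.1]
  calc _ = ∫ ω, (Z ω * splitTerm T η t f n ω -
        Z ω * extSum T η t n ω * ((∫ x, f x ∂ν) / (n + 1))) * d n ∂P := by
        refine integral_congr_ae (hinc.mono fun ω hω => ?_)
        by_cases h : ω ∈ A
        · simp only [hZ, Set.indicator_of_mem h]
          rw [hω n]
          ring
        · simp only [hZ, Set.indicator_of_notMem h]
          ring
    _ = 0 := by
        rw [integral_mul_const, integral_sub hi1 (hi2.mul_const _), integral_mul_const,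
          hM.integral_mul_splitTerm t hZm hZa hZb hf hfb]
        ring

lemma IsLabelledBST.integral_splitTerm (hM : IsLabelledBST P T η ν) (t : E) {f : E × E → ℂ}
    (hf : Measurable f) {K : ℝ} (hfb : ∀ x, ‖f x‖ ≤ K) (n : ℕ) :
    ∫ ω, splitTerm T η t f n ω ∂P = (∫ ω, extSum T η t n ω ∂P) * (∫ x, f x ∂ν) / (n + 1) := by
  have := hM.integral_mul_splitTerm t (n := n) (Z := fun _ => 1) measurable_const
    (AdaptedAt.const 1) (C := 1) (ae_of_all _ fun _ => by simp) hf hfb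
  simpa using this

/-- At the character 0 the external sum is exactly n + 1 and cancels the denominator of the
averaging formula. -/
lemma IsLabelledBST.integral_norm_splitTerm_sq (hM : IsLabelledBST P T η ν) (t : E)
    {f : E × E → ℂ} (hf : Measurable f) {K : ℝ} (hfb : ∀ x, ‖f x‖ ≤ K) (n : ℕ) :
    ∫ ω, ‖splitTerm T η t f n ω‖ ^ 2 ∂P = ∫ x, ‖f x‖ ^ 2 ∂ν := by
  have h1 := hM.integral_splitTerm 0 (f := fun x => ((‖f x‖ ^ 2 : ℝ) : ℂ))
    (Complex.continuous_ofReal.measurable.comp (hf.norm.pow_const 2)) (K := K ^ 2) (fun x => by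
      rw [Complex.norm_real, Real.norm_of_nonneg (by positivity)]
      exact pow_le_pow_left₀ (norm_nonneg _) (hfb x) 2) n
  have h2 : ∫ ω, extSum T η (0 : E) n ω ∂P = n + 1 := by
    rw [integral_congr_ae (hM.ae_extSum_zero_left.mono fun ω hω => hω n)]
    simp
  have h3 : (n : ℂ) + 1 ≠ 0 := by exact_mod_cast n.succ_ne_zero
  rw [← integral_congr_ae ((hM.ae_normSq_splitTerm t f).mono fun ω hω => hω n), h2,
    mul_div_cancel_left₀ _ h3, integral_complex_ofReal, integral_complex_ofReal] at h1
  exact_mod_cast h1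

lemma IsLabelledBST.integral_extSum (hM : IsLabelledBST P T η ν) (t : E) (n : ℕ) :
    ∫ ω, extSum T η t n ω ∂P = growth (kappa ν t) n := by
  induction n with
  | zero =>
    rw [integral_congr_ae (hM.ae_extSum_zero t), growth_zero]
    simp
  | succ n ih =>
    have hi1 : Integrable (extSum T η t n) P :=
      integrable_of_ae_bound (hM.measurable_extSum t n).aestronglyMeasurable
        ⟨_, (hM.ae_norm_extSum_le t).mono fun ω hω => hω n⟩
    have hi2 : Integrable (splitTerm T η t (offspring t) n) P :=
      integrable_of_ae_bound
        (hM.measurable_splitTerm t (measurable_offspring t) n).aestronglyMeasurable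
        ⟨_, (hM.ae_norm_splitTerm_le t (norm_offspring_le t)).mono fun ω hω => hω n⟩
    rw [integral_congr_ae ((hM.ae_extSum_succ t).mono fun ω hω => hω n), integral_add hi1 hi2,
      hM.integral_splitTerm t (measurable_offspring t) (norm_offspring_le t), ih, growth_succ]
    change _ + growth _ n * kappa ν t / _ = _
    ring

lemma IsLabelledBST.integral_norm_extSum_sq_succ (hM : IsLabelledBST P T η ν) (t : E) (n : ℕ) :
    ∫ ω, ‖extSum T η t (n + 1) ω‖ ^ 2 ∂P =
      (∫ ω, ‖extSum T η t n ω‖ ^ 2 ∂P) * (1 + 2 * (kappa ν t).re / (n + 1)) +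
        ∫ x, ‖offspring t x‖ ^ 2 ∂ν := by
  have hb1 : ∀ᵐ ω ∂P, ‖extSum T η t n ω‖ ≤ n + 1 :=
    (hM.ae_norm_extSum_le t).mono fun ω hω => hω n
  have hb2 : ∀ᵐ ω ∂P, ‖splitTerm T η t (offspring t) n ω‖ ≤ 3 :=
    (hM.ae_norm_splitTerm_le t (norm_offspring_le t)).mono fun ω hω => hω n
  have hb3 : ∀ᵐ ω ∂P, ‖conj (extSum T η t n ω)‖ ≤ n + 1 := by simpa using hb1
  have h1 := setIntegral_norm_add_sq (hM.measurable_extSum t n)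
    (hM.measurable_splitTerm t (measurable_offspring t) n) ⟨_, hb1⟩ ⟨_, hb2⟩ Set.univ
  simp only [setIntegral_univ] at h1
  have h2 := hM.integral_mul_splitTerm t
    (Complex.continuous_conj.measurable.comp (hM.measurable_extSum t n))
    ((adaptedAt_extSum t n).comp Complex.continuous_conj.measurable) hb3
    (measurable_offspring t) (norm_offspring_le t)
  have h3 : ∫ ω, conj (extSum T η t n ω) * extSum T η t n ω ∂P =
      ((∫ ω, ‖extSum T η t n ω‖ ^ 2 ∂P : ℝ) : ℂ) := by
    rw [← integral_complex_ofReal]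
    refine integral_congr_ae (ae_of_all _ fun ω => ?_)
    simp only [Complex.conj_mul']
    push_cast
    rfl
  have h4 : ∫ ω, ‖extSum T η t (n + 1) ω‖ ^ 2 ∂P =
      ∫ ω, ‖extSum T η t n ω + splitTerm T η t (offspring t) n ω‖ ^ 2 ∂P :=
    integral_congr_ae ((hM.ae_extSum_succ t).mono fun ω hω => by simp only [hω n])
  simp only [Function.comp_apply] at h2
  rw [h4, h1, h2, h3, hM.integral_norm_splitTerm_sq t (measurable_offspring t)
    (norm_offspring_le t)]
  change _ + _ + 2 * (((_ : ℝ) : ℂ) * kappa ν t / ((n : ℂ) + 1)).re = _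
  have h5 : ∀ a : ℝ, ((a : ℂ) * kappa ν t / ((n : ℂ) + 1)).re =
      a * (kappa ν t).re / (n + 1) := fun a => by
    have : (n : ℂ) + 1 = ((n + 1 : ℝ) : ℂ) := by push_cast; rfl
    rw [this, Complex.div_ofReal_re, Complex.re_ofReal_mul]
  rw [h5]
  ring

/-- The normalised sum of a character over external nodes stays close to its initial value. -/
lemma IsLabelledBST.measure_extSum_div_growth (hM : IsLabelledBST P T η ν) {t : E}
    (ht : 1 - (kappa ν t).re ≤ 1 / 4) {ε : ℝ} (hε : 0 < ε) :
    P {ω | ∃ n, ε ≤ ‖extSum T η t n ω / growth (kappa ν t) n - 1‖} ≤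
      ENNReal.ofReal (momentConst * (1 - (kappa ν t).re) / ε ^ 2) := by
  set κ := kappa ν t with hκ
  set δ := 1 - κ.re with hδ
  have hδ0 : 0 ≤ δ := one_sub_re_kappa_nonneg ν t
  have hκδ : κ.re = 1 - δ := by rw [hδ]; ring
  have hne : ∀ n, growth κ n ≠ 0 := growth_ne_zero hδ0 (by linarith) hκδ
  have hm : ∀ n, Measurable fun ω => extSum T η t n ω / growth κ n - 1 := fun n =>
    ((hM.measurable_extSum t n).div_const _).sub_const 1
  have ha : ∀ n, AdaptedAt T η n fun ω => extSum T η t n ω / growth κ n - 1 := fun n =>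
    (adaptedAt_extSum t n).comp (φ := fun z => z / growth κ n - 1)
      ((measurable_id.div_const _).sub_const 1)
  have hb : ∀ n, ∃ C, ∀ᵐ ω ∂P, ‖extSum T η t n ω / growth κ n - 1‖ ≤ C := fun n => by
    refine ⟨((n : ℝ) + 1) / ‖growth κ n‖ + 1, (hM.ae_norm_extSum_le t).mono fun ω hω => ?_⟩
    refine (norm_sub_le _ _).trans ?_
    rw [norm_div, norm_one]
    gcongr
    exact hω n
  refine measure_exists_le_norm (𝒢 := history T η) (fun n => (ha n).measurable_history (hm n)) hb
    (fun n A hA => hM.setIntegral_conj_mul_eq_zero t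
      (N := fun n ω => extSum T η t n ω / growth κ n - 1) hm ha hb
      (measurable_offspring t) (norm_offspring_le t) (fun n => (growth κ (n + 1))⁻¹) ?_ n hA)
    (fun n => ?_) hε
  · filter_upwards [hM.ae_extSum_succ t] with ω hω n
    have h1 := hne n
    have h2 := hne (n + 1)
    have h3 : extSum T η t n ω / growth κ n =
        extSum T η t n ω * (1 + κ / (n + 1)) / growth κ (n + 1) := by
      rw [div_eq_div_iff h1 h2, growth_succ]; ring
    rw [hω n, h3]
    change _ = (_ - _ * κ / _) * _
    field_simp
    ring
  · have hw := secondMoment_le hδ0 ht hκδ (integral_norm_offspring_sq_le ν t)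
      (w := fun n => ∫ ω, ‖extSum T η t n ω‖ ^ 2 ∂P)
      (by
        rw [integral_congr_ae (g := fun _ => (1 : ℝ)) ((hM.ae_extSum_zero t).mono fun ω hω => by
          simp [hω])]
        simp)
      (hM.integral_norm_extSum_sq_succ t) n
    have hi : Integrable (extSum T η t n) P :=
      integrable_of_ae_bound (hM.measurable_extSum t n).aestronglyMeasurable
        ⟨_, (hM.ae_norm_extSum_le t).mono fun ω hω => hω n⟩
    have h1 := setIntegral_norm_add_sq (P := P) (f := fun _ => -1)
      (g := fun ω => extSum T η t n ω / growth κ n) measurable_const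
      ((hM.measurable_extSum t n).div_const _) ⟨1, by simp⟩
      ⟨((n : ℝ) + 1) / ‖growth κ n‖, (hM.ae_norm_extSum_le t).mono fun ω hω => by
        rw [norm_div]; gcongr; exact hω n⟩ Set.univ
    simp only [setIntegral_univ, map_neg, map_one, neg_mul, one_mul, norm_neg, norm_one, norm_div,
      div_pow, neg_add_eq_sub] at h1
    -- The normalised sum has mean 1, so E|M - 1|² = E|M|² - 1.
    rw [h1, integral_neg, integral_div, integral_div, hM.integral_extSum, div_self (hne n)]
    simp only [integral_const, probReal_univ, smul_eq_mul, one_pow, mul_one, Complex.neg_re,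
      Complex.one_re]
    have h2 : 0 < ‖growth κ n‖ ^ 2 := by have := norm_pos_iff.2 (hne n); positivity
    have h3 : (∫ ω, ‖extSum T η t n ω‖ ^ 2 ∂P) / ‖growth κ n‖ ^ 2 ≤ 1 + momentConst * δ := by
      rw [div_le_iff₀ h2, mul_comm]; exact hw
    linarith

/-- The increment of the martingale `κ G_n - F_n` comparing internal and external nodes. -/
noncomputable def compareTerm (T : ℕ → Ω → BinTree) (η : Node → Ω → E × E) (ν : Measure (E × E))
    (t : E) (n : ℕ) (ω : Ω) : ℂ :=
  kappa ν t * (intSum T η t (n + 1) ω - intSum T η t n ω) -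
    (extSum T η t (n + 1) ω - extSum T η t n ω)

lemma integral_kappa_sub_offspring (t : E) : ∫ x, (kappa ν t - offspring t x) ∂ν = 0 := by
  rw [integral_sub (integrable_const _) (integrable_offspring ν t)]
  simp [kappa]

lemma norm_kappa_le (t : E) : ‖kappa ν t‖ ≤ 3 := by
  have := norm_integral_le_of_norm_le_const (μ := ν) (ae_of_all _ (norm_offspring_le t))
  rwa [probReal_univ, mul_one] at this

lemma norm_kappa_sub_offspring_le (t : E) (x : E × E) : ‖kappa ν t - offspring t x‖ ≤ 6 :=
  (norm_sub_le _ _).trans (by linarith [norm_kappa_le (ν := ν) t, norm_offspring_le t x])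

/-- This is the variance E|offspring|² - |κ|², at most (1 + 2δ) - (1 - δ)² = 4δ - δ² with δ = 1 - Re
κ. -/
lemma integral_norm_kappa_sub_offspring_sq_le {t : E} (ht : 1 - (kappa ν t).re ≤ 1) :
    ∫ x, ‖kappa ν t - offspring t x‖ ^ 2 ∂ν ≤ 4 * (1 - (kappa ν t).re) := by
  have h1 := setIntegral_norm_add_sq (P := ν) (f := fun _ => -kappa ν t) (g := offspring t)
    measurable_const (measurable_offspring t) ⟨_, ae_of_all _ fun _ => le_rfl⟩
    ⟨3, ae_of_all _ (norm_offspring_le t)⟩ Set.univ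
  simp only [setIntegral_univ, norm_neg, map_neg, neg_mul, neg_add_eq_sub] at h1
  simp_rw [norm_sub_rev (kappa ν t)]
  rw [h1, integral_neg, integral_const_mul]
  change _ + _ + 2 * (-(conj (kappa ν t) * kappa ν t)).re ≤ _
  rw [Complex.conj_mul']
  have h2 : (-((‖kappa ν t‖ : ℂ) ^ 2)).re = -‖kappa ν t‖ ^ 2 := by
    rw [← Complex.ofReal_pow, ← Complex.ofReal_neg, Complex.ofReal_re]
  rw [h2]
  have h3 := integral_norm_offspring_sq_le ν t
  have h4 : (kappa ν t).re ^ 2 ≤ ‖kappa ν t‖ ^ 2 :=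
    pow_le_pow_left₀ (by linarith) (Complex.re_le_norm _) 2
  simp only [integral_const, probReal_univ, smul_eq_mul, one_mul]
  nlinarith [sq_nonneg (1 - (kappa ν t).re)]

/-- Splitting v adds the phase of v to the internal sum and that phase times `offspring` to the
external one; the difference has conditional mean 0. -/
lemma IsLabelledBST.ae_compareTerm (hM : IsLabelledBST P T η ν) (t : E) : ∀ᵐ ω ∂P, ∀ n,
    compareTerm T η ν t n ω = splitTerm T η t (fun x => kappa ν t - offspring t x) n ω := by
  filter_upwards [hM.ae_split] with ω hω n
  obtain ⟨hp, -, -, v, hv1, hv2⟩ := hω n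
  rw [compareTerm, splitTerm, intSum, intSum, extSum, extSum, hv2, charSum_external_split t hp hv1,
    charSum_internal_split t hp hv1, increment_split t _ hp hv1]
  ring

lemma IsLabelledBST.measurable_compareTerm (hM : IsLabelledBST P T η ν) (t : E) (n : ℕ) :
    Measurable (compareTerm T η ν t n) :=
  (((hM.measurable_intSum t (n + 1)).sub (hM.measurable_intSum t n)).const_mul _).sub
    ((hM.measurable_extSum t (n + 1)).sub (hM.measurable_extSum t n))

lemma AdaptedAt.sub {n : ℕ} {Z W : Ω → ℂ} (hZ : AdaptedAt T η n Z) (hW : AdaptedAt T η n W) :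
    AdaptedAt T η n fun ω => Z ω - W ω :=
  (hZ.prodMk hW).comp (measurable_fst.sub measurable_snd)

lemma AdaptedAt.add {n : ℕ} {Z W : Ω → ℂ} (hZ : AdaptedAt T η n Z) (hW : AdaptedAt T η n W) :
    AdaptedAt T η n fun ω => Z ω + W ω :=
  (hZ.prodMk hW).comp (measurable_fst.add measurable_snd)

lemma adaptedAt_compareTerm (t : E) (n : ℕ) :
    AdaptedAt T η (n + 1) (compareTerm T η ν t n) :=
  (((adaptedAt_intSum t (n + 1)).sub ((adaptedAt_intSum t n).mono n.le_succ)).comp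
    (measurable_id.const_mul (kappa ν t))).sub
      ((adaptedAt_extSum t (n + 1)).sub ((adaptedAt_extSum t n).mono n.le_succ))

lemma adaptedAt_sum_compareTerm (t : E) (n : ℕ) :
    AdaptedAt T η n fun ω => ∑ j ∈ Finset.range n, compareTerm T η ν t j ω / (j + 1) := by
  induction n with
  | zero => simpa using AdaptedAt.const (T := T) (η := η) (n := 0) (0 : ℂ)
  | succ n ih =>
    simp only [Finset.sum_range_succ]
    exact (ih.mono n.le_succ).add
      ((adaptedAt_compareTerm t n).comp (measurable_id.div_const ((n : ℂ) + 1)))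

/-- The weighted sums of the increments of `κ G_n - F_n` stay small. -/
lemma IsLabelledBST.measure_sum_compareTerm (hM : IsLabelledBST P T η ν) {t : E}
    (ht : 1 - (kappa ν t).re ≤ 1) {ε : ℝ} (hε : 0 < ε) :
    P {ω | ∃ n, ε ≤ ‖∑ j ∈ Finset.range n, compareTerm T η ν t j ω / (j + 1)‖} ≤
      ENNReal.ofReal (8 * (1 - (kappa ν t).re) / ε ^ 2) := by
  have hδ0 : 0 ≤ 1 - (kappa ν t).re := one_sub_re_kappa_nonneg ν t
  have hfm : Measurable fun x => kappa ν t - offspring t x :=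
    measurable_const.sub (measurable_offspring t)
  have hfb := norm_kappa_sub_offspring_le (ν := ν) t
  have hm : ∀ n, Measurable fun ω =>
      ∑ j ∈ Finset.range n, compareTerm T η ν t j ω / (j + 1) := fun n =>
    Finset.measurable_sum _ fun j _ => (hM.measurable_compareTerm t j).div_const _
  have ha := adaptedAt_sum_compareTerm (T := T) (η := η) (ν := ν) t
  have hb : ∀ n, ∃ C, ∀ᵐ ω ∂P, ‖∑ j ∈ Finset.range n, compareTerm T η ν t j ω / (j + 1)‖ ≤ C :=
    fun n => by
    refine ⟨∑ j ∈ Finset.range n, 6 / ‖(j : ℂ) + 1‖, ?_⟩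
    filter_upwards [hM.ae_compareTerm t, hM.ae_norm_splitTerm_le t hfb] with ω h1 h2
    refine norm_sum_le_of_le _ fun j _ => ?_
    rw [norm_div, h1]
    gcongr
    exact h2 j
  have horth : ∀ n A, MeasurableSet[history T η n] A →
      ∫ ω in A, conj (∑ j ∈ Finset.range n, compareTerm T η ν t j ω / (j + 1)) *
        (∑ j ∈ Finset.range (n + 1), compareTerm T η ν t j ω / (j + 1) -
          ∑ j ∈ Finset.range n, compareTerm T η ν t j ω / (j + 1)) ∂P = 0 := fun n A hA =>
    hM.setIntegral_conj_mul_eq_zero t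
      (N := fun n ω => ∑ j ∈ Finset.range n, compareTerm T η ν t j ω / (j + 1)) hm ha hb
      hfm hfb (fun n => ((n : ℂ) + 1)⁻¹) (by
        filter_upwards [hM.ae_compareTerm t] with ω hω n
        rw [integral_kappa_sub_offspring, Finset.sum_range_succ, hω n]
        ring) n hA
  refine measure_exists_le_norm (𝒢 := history T η) (fun n => (ha n).measurable_history (hm n)) hb
    horth (fun n => ?_) hε
  -- Increments are orthogonal, so their mean squares add up. The weights 1/(j+1) are square
  -- summable, which keeps the bound independent of n.
  have key : ∀ n, ∫ ω, ‖∑ j ∈ Finset.range n, compareTerm T η ν t j ω / (j + 1)‖ ^ 2 ∂P ≤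
      4 * (1 - (kappa ν t).re) * ∑ k ∈ Finset.range n, 1 / ((k : ℝ) + 1) ^ 2 := by
    intro n
    induction n with
    | zero => simp
    | succ n ih =>
      have h1 := setIntegral_norm_sq_succ (P := P) (𝒢 := history T η)
        (N := fun n ω => ∑ j ∈ Finset.range n, compareTerm T η ν t j ω / (j + 1))
        (fun n => (ha n).measurable_history (hm n)) hb horth n (A := Set.univ)
        MeasurableSet.univ
      simp only [setIntegral_univ] at h1
      rw [h1, Finset.sum_range_succ, mul_add]
      refine add_le_add ih ?_
      have hn : ‖(n : ℂ) + 1‖ = (n : ℝ) + 1 := by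
        have : (n : ℂ) + 1 = ((n + 1 : ℕ) : ℂ) := by push_cast; rfl
        rw [this, Complex.norm_natCast]; push_cast; rfl
      have h2 : ∫ ω, ‖∑ j ∈ Finset.range (n + 1), compareTerm T η ν t j ω / (j + 1) -
          ∑ j ∈ Finset.range n, compareTerm T η ν t j ω / (j + 1)‖ ^ 2 ∂P =
          (∫ ω, ‖splitTerm T η t (fun x => kappa ν t - offspring t x) n ω‖ ^ 2 ∂P) *
            (1 / ((n : ℝ) + 1) ^ 2) := by
        rw [← integral_mul_const]
        refine integral_congr_ae ((hM.ae_compareTerm t).mono fun ω hω => ?_)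
        simp only [Finset.sum_range_succ, add_sub_cancel_left, norm_div, hω n, hn, div_pow]
        ring
      rw [h2, hM.integral_norm_splitTerm_sq t hfm hfb]
      gcongr
      exact integral_norm_kappa_sub_offspring_sq_le ht
  calc _ ≤ _ := key n
    _ ≤ 4 * (1 - (kappa ν t).re) * 2 := by gcongr; exact sum_inv_sq_le n
    _ = _ := by ring

end Martingales

/-! ### Borel–Cantelli, uniformly in time -/

section BorelCantelli

variable {Ω : Type*} [MeasurableSpace Ω] {P : Measure Ω}

/-- The exceptional events include all n at once, so k may afterwards be made a function of n.
Values ε = 1/(j+1) suffice, which leaves countably many null sets. -/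
lemma ae_forall_eventually_norm_lt {N : ℕ → ℕ → Ω → ℂ} {b : ℕ → ℝ} (hb : Summable b)
    (h : ∀ ε > 0, ∀ᶠ k in atTop,
      P {ω | ∃ n, ε ≤ ‖N k n ω‖} ≤ ENNReal.ofReal (b k / ε ^ 2)) :
    ∀ᵐ ω ∂P, ∀ ε > 0, ∀ᶠ k in atTop, ∀ n, ‖N k n ω‖ < ε := by
  have key : ∀ j : ℕ, ∀ᵐ ω ∂P, ∀ᶠ k in atTop, ∀ n, ‖N k n ω‖ < 1 / ((j : ℝ) + 1) := by
    intro j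
    have hj : (0 : ℝ) < 1 / ((j : ℝ) + 1) := by positivity
    obtain ⟨k₀, hk₀⟩ := eventually_atTop.1 (h _ hj)
    have hsum : ∑' k, P {ω | ∃ n, 1 / ((j : ℝ) + 1) ≤ ‖N (k + k₀) n ω‖} ≠ ⊤ := by
      refine ne_top_of_le_ne_top ?_ (ENNReal.tsum_le_tsum fun k => hk₀ (k + k₀) (Nat.le_add_left _ _))
      exact (((summable_nat_add_iff k₀).2 hb).div_const _).tsum_ofReal_ne_top
    filter_upwards [ae_eventually_notMem hsum] with ω hω
    obtain ⟨k₁, hk₁⟩ := eventually_atTop.1 hω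
    refine eventually_atTop.2 ⟨k₁ + k₀, fun k hk n => ?_⟩
    have := hk₁ (k - k₀) (by omega)
    simp only [not_exists, not_le, Nat.sub_add_cancel (show k₀ ≤ k by omega)] at this
    exact this n
  filter_upwards [ae_all_iff.2 key] with ω hω ε hε
  obtain ⟨j, hj⟩ := exists_nat_one_div_lt hε
  exact (hω j).mono fun k hk n => (hk n).trans hj

end BorelCantelli

/-! ### Characteristic functions of empirical and rescaled measures -/

section Empirical

variable {E : Type*} [NormedAddCommGroup E] [InnerProductSpace ℝ E] [MeasurableSpace E]
  [BorelSpace E] [SecondCountableTopology E]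

lemma charFun_rescale (a : ℝ) (b : E) (μ : ProbabilityMeasure E) (s : E) :
    charFun (rescale a b μ : Measure E) s =
      charFun (μ : Measure E) (a⁻¹ • s) * Complex.exp (-(inner ℝ b (a⁻¹ • s) * Complex.I)) := by
  change charFun ((μ : Measure E).map fun x => a⁻¹ • (x - b)) s = _
  rw [charFun_map_smul_comp (by fun_prop)]
  simp_rw [sub_eq_add_neg]
  rw [charFun_map_add_const, inner_neg_left]
  push_cast
  rw [neg_mul]

lemma charFun_empirical {S : Finset Node} (hS : S.Nonempty) (x : Node → E × E) (t : E) :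
    charFun (empirical S (walk x) : Measure E) t = charSum t S x / S.card := by
  have : (empirical S (walk x) : Measure E) =
      (S.card : ENNReal)⁻¹ • ∑ v ∈ S, Measure.dirac (walk x v) :=
    congrArg (fun μ : ProbabilityMeasure E => (μ : Measure E)) (dif_pos hS)
  rw [this, charFun_apply, integral_smul_measure, integral_finsetSum_measure fun v _ =>
    integrable_dirac (by simp)]
  simp only [integral_dirac, charSum, phase]
  rw [ENNReal.toReal_inv, ENNReal.toReal_natCast, Complex.real_smul]
  push_cast
  ring

lemma charFun_empirical_empty (x : Node → E × E) (t : E) :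
    charFun (empirical ∅ (walk x) : Measure E) t = 1 := by
  have : (empirical ∅ (walk x) : Measure E) = Measure.dirac 0 :=
    congrArg (fun μ : ProbabilityMeasure E => (μ : Measure E)) (dif_neg Finset.not_nonempty_empty)
  rw [this, charFun_dirac]
  simp

lemma measurable_charFun_empirical {Ω : Type*} [MeasurableSpace Ω] {τ : Ω → BinTree}
    (hτ : Measurable τ) {η : Node → Ω → E × E} (hη : ∀ v, Measurable (η v))
    (σ : BinTree → Finset Node) (t : E) :
    Measurable fun ω => charFun (empirical (σ (τ ω)) (walk fun v => η v ω) : Measure E) t := by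
  refine measurable_apply_countable hτ
    (Ψ := fun τ ω => charFun (empirical (σ τ) (walk fun v => η v ω) : Measure E) t) fun τ => ?_
  rcases (σ τ).eq_empty_or_nonempty with h | h
  · simp only [h, charFun_empirical_empty]
    exact measurable_const
  · simp only [charFun_empirical h]
    exact ((measurable_charSum t (σ τ)).comp (measurable_pi_lambda _ hη)).div_const _

end Empirical

/-! ### Limits at the scale ⌊√(log n)⌋ and the three limit theorems -/

section Limit

variable {d : ℕ} {Ω : Type*} [MeasurableSpace Ω] {P : Measure Ω} [IsProbabilityMeasure P]
  {T : ℕ → Ω → BinTree} {η : Node → Ω → EuclideanSpace ℝ (Fin d) × EuclideanSpace ℝ (Fin d)}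
  {ν : Measure (EuclideanSpace ℝ (Fin d) × EuclideanSpace ℝ (Fin d))} [IsProbabilityMeasure ν]

local notation "𝔼" => EuclideanSpace ℝ (Fin d)

/-- The phase by which centring changes characteristic functions. -/
noncomputable def centring (ν : Measure (𝔼 × 𝔼)) (s : 𝔼) (n : ℕ) : ℂ :=
  inner ℝ (Real.log n • meanSum ν) ((scale n : ℝ)⁻¹ • s) * Complex.I

lemma norm_exp_neg_centring (s : 𝔼) (n : ℕ) : ‖Complex.exp (-centring ν s n)‖ = 1 := by
  rw [centring, ← neg_mul, ← Complex.ofReal_neg, Complex.norm_exp_ofReal_mul_I]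

lemma tendsto_inv_scale : Tendsto (fun n => (scale n : ℝ)⁻¹) atTop (𝓝[≠] 0) := by
  refine tendsto_nhdsWithin_iff.2 ⟨tendsto_inv_atTop_zero.comp
    (tendsto_natCast_atTop_atTop.comp tendsto_scale), ?_⟩
  filter_upwards [tendsto_scale.eventually_gt_atTop 0] with n hn
  simpa using hn.ne'

lemma one_sub_re_kappa_inv_smul_le (hν : Integrable (fun x => ‖x.1‖ ^ 2 + ‖x.2‖ ^ 2) ν) (s : 𝔼)
    (k : ℕ) : 1 - (kappa ν ((k : ℝ)⁻¹ • s)).re ≤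
      1 / (k : ℝ) ^ 2 * (‖s‖ ^ 2 * ∫ x, (‖x.1‖ ^ 2 + ‖x.2‖ ^ 2) ∂ν) := by
  refine (one_sub_re_kappa_le ν hν _).trans_eq ?_
  rw [norm_smul, mul_pow, norm_inv, inv_pow, Real.norm_natCast, one_div, mul_assoc]

lemma summable_one_sub_re_kappa (hν : Integrable (fun x => ‖x.1‖ ^ 2 + ‖x.2‖ ^ 2) ν) (s : 𝔼) :
    Summable fun k : ℕ => 1 - (kappa ν ((k : ℝ)⁻¹ • s)).re := by
  refine Summable.of_nonneg_of_le (fun k => one_sub_re_kappa_nonneg ν _)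
    (one_sub_re_kappa_inv_smul_le hν s) ?_
  exact (Real.summable_one_div_nat_pow.2 one_lt_two).mul_right _

/-- With c = 1/scale n, the linear term of κ - 1 times log n is exactly the centring phase, and the
quadratic term meets c² log n → 1. -/
lemma tendsto_kappa_sub_one_mul_log (hν : Integrable (fun x => ‖x.1‖ ^ 2 + ‖x.2‖ ^ 2) ν) (s : 𝔼) :
    Tendsto (fun n : ℕ => (kappa ν ((scale n : ℝ)⁻¹ • s) - 1) * Real.log n - centring ν s n) atTop
      (𝓝 (-(quadForm ν s : ℂ) / 2)) := by
  have h1 := (tendsto_kappa_expansion hν s).comp tendsto_inv_scale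
  have h2 := (Complex.continuous_ofReal.tendsto _).comp tendsto_log_div_scale_sq
  have h3 := h1.mul h2
  rw [Complex.ofReal_one, mul_one] at h3
  refine h3.congr' ?_
  filter_upwards [tendsto_scale.eventually_gt_atTop 0] with n hn
  have hn' : (scale n : ℂ) ≠ 0 := by exact_mod_cast hn.ne'
  simp only [Function.comp_apply, centring, meanSum, inner_smul_left, inner_smul_right,
    RCLike.conj_to_real]
  push_cast
  field_simp

lemma tendsto_kappa_inv_scale (hν : Integrable (fun x => ‖x.1‖ ^ 2 + ‖x.2‖ ^ 2) ν) (s : 𝔼) :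
    Tendsto (fun n : ℕ => kappa ν ((scale n : ℝ)⁻¹ • s) - 1) atTop (𝓝 0) := by
  have h1 := (tendsto_kappa_expansion hν s).comp tendsto_inv_scale
  have h0 : Tendsto (fun n => (scale n : ℝ)⁻¹) atTop (𝓝 0) :=
    tendsto_inv_scale.mono_right nhdsWithin_le_nhds
  have h2 : Tendsto (fun n => (((scale n : ℝ)⁻¹ : ℝ) : ℂ)) atTop (𝓝 0) := by
    have := (Complex.continuous_ofReal.tendsto _).comp h0
    rwa [Complex.ofReal_zero] at this
  have h3 := (h1.mul (h2.pow 2)).add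
    (h2.mul_const ((inner ℝ ((∫ x, x.1 ∂ν) + ∫ x, x.2 ∂ν) s : ℝ) * Complex.I))
  simp only [ne_eq, OfNat.ofNat_ne_zero, not_false_eq_true, zero_pow, mul_zero, zero_mul,
    add_zero] at h3
  refine h3.congr' ?_
  filter_upwards [tendsto_scale.eventually_gt_atTop 0] with n hn
  have hn' : (scale n : ℂ) ≠ 0 := by exact_mod_cast hn.ne'
  simp only [Function.comp_apply]
  push_cast
  field_simp
  ring

lemma IsLabelledBST.ae_tendsto_extSum (hM : IsLabelledBST P T η ν)
    (hν : Integrable (fun x => ‖x.1‖ ^ 2 + ‖x.2‖ ^ 2) ν) (s : 𝔼) : ∀ᵐ ω ∂P, Tendsto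
      (fun n : ℕ => extSum T η ((scale n : ℝ)⁻¹ • s) n ω / (n + 1) *
        Complex.exp (-centring ν s n)) atTop (𝓝 (Complex.exp (-(quadForm ν s : ℂ) / 2))) := by
  have hsum := summable_one_sub_re_kappa hν s
  have hsmall : ∀ᶠ k : ℕ in atTop, 1 - (kappa ν ((k : ℝ)⁻¹ • s)).re ≤ 1 / 4 :=
    hsum.tendsto_atTop_zero.eventually_le_const (by norm_num)
  have hBC := ae_forall_eventually_norm_lt (P := P)
    (N := fun k n ω => extSum T η ((k : ℝ)⁻¹ • s) n ω / growth (kappa ν ((k : ℝ)⁻¹ • s)) n - 1)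
    (hsum.mul_left momentConst) fun ε hε =>
      hsmall.mono fun k hk => hM.measure_extSum_div_growth hk hε
  filter_upwards [hBC] with ω hω
  have h1 : Tendsto (fun n : ℕ => extSum T η ((scale n : ℝ)⁻¹ • s) n ω /
      growth (kappa ν ((scale n : ℝ)⁻¹ • s)) n - 1) atTop (𝓝 0) := by
    rw [Metric.tendsto_atTop']
    intro ε hε
    -- The bound holds for every time once k is large, in particular at k = scale n and time n.
    obtain ⟨N, hN⟩ := eventually_atTop.1 (tendsto_scale.eventually (hω ε hε))
    exact ⟨N, fun n hn => by rw [dist_zero_right]; exact hN n hn.le n⟩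
  have h2 := tendsto_growth_div (tendsto_kappa_inv_scale hν s) (tendsto_kappa_sub_one_mul_log hν s)
  have h3 := (h1.add_const 1).mul h2
  rw [zero_add, one_mul] at h3
  refine h3.congr' ?_
  filter_upwards [tendsto_scale.eventually hsmall] with n hn
  have hne : growth (kappa ν ((scale n : ℝ)⁻¹ • s)) n ≠ 0 :=
    growth_ne_zero (one_sub_re_kappa_nonneg ν _) (hn.trans (by norm_num)) (by ring) n
  rw [sub_add_cancel, add_sub_cancel, ← mul_assoc, div_mul_div_cancel₀ hne]

lemma IsLabelledBST.ae_tendsto_intSum (hM : IsLabelledBST P T η ν)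
    (hν : Integrable (fun x => ‖x.1‖ ^ 2 + ‖x.2‖ ^ 2) ν) (s : 𝔼) : ∀ᵐ ω ∂P, Tendsto
      (fun n : ℕ => intSum T η ((scale n : ℝ)⁻¹ • s) n ω / n *
        Complex.exp (-centring ν s n)) atTop (𝓝 (Complex.exp (-(quadForm ν s : ℂ) / 2))) := by
  have hsum := summable_one_sub_re_kappa hν s
  have hsmall : ∀ᶠ k : ℕ in atTop, 1 - (kappa ν ((k : ℝ)⁻¹ • s)).re ≤ 1 :=
    hsum.tendsto_atTop_zero.eventually_le_const (by norm_num)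
  have hBC := ae_forall_eventually_norm_lt (P := P)
    (N := fun k n ω => ∑ j ∈ Finset.range n, compareTerm T η ν ((k : ℝ)⁻¹ • s) j ω / (j + 1))
    (hsum.mul_left 8) fun ε hε => hsmall.mono fun k hk => hM.measure_sum_compareTerm hk hε
  have h0 : ∀ᵐ ω ∂P, ∀ k : ℕ, extSum T η ((k : ℝ)⁻¹ • s) 0 ω = 1 ∧
      intSum T η ((k : ℝ)⁻¹ • s) 0 ω = 0 :=
    ae_all_iff.2 fun k => (hM.ae_extSum_zero _).and (hM.ae_intSum_zero _)
  filter_upwards [hBC, h0, hM.ae_tendsto_extSum hν s] with ω hω hω0 hext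
  set t : ℕ → 𝔼 := fun n => (scale n : ℝ)⁻¹ • s with ht
  have hκ : Tendsto (fun n => kappa ν (t n)) atTop (𝓝 1) := by
    simpa using (tendsto_kappa_inv_scale hν s).add_const 1
  -- The summand 1 is the external sum at time 0, left over when the increments telescope; the
  -- internal sum starts at 0. Below, summation by parts turns the bound ε/4 into nε/2.
  have hcomp : Tendsto (fun n : ℕ => (kappa ν (t n) * intSum T η (t n) n ω -
      extSum T η (t n) n ω + 1) / n) atTop (𝓝 0) := by
    rw [Metric.tendsto_atTop']
    intro ε hε
    obtain ⟨N, hN⟩ := eventually_atTop.1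
      (tendsto_scale.eventually (hω (ε / 4) (by positivity)))
    refine ⟨N, fun n hn => ?_⟩
    have h1 := norm_sum_le_of_norm_sum_div_le (fun m => (hN n hn.le m).le) n
    have h2 : ∑ j ∈ Finset.range n, compareTerm T η ν (t n) j ω =
        kappa ν (t n) * intSum T η (t n) n ω - extSum T η (t n) n ω + 1 := by
      simp only [compareTerm]
      rw [Finset.sum_sub_distrib, ← Finset.mul_sum,
        Finset.sum_range_sub (fun j => intSum T η (t n) j ω),
        Finset.sum_range_sub (fun j => extSum T η (t n) j ω), (hω0 (scale n)).1,
        (hω0 (scale n)).2]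
      ring
    have hn0 : (0 : ℝ) < n := by exact_mod_cast (Nat.zero_le N).trans_lt hn
    rw [dist_zero_right, ← h2, norm_div, Complex.norm_natCast, div_lt_iff₀ hn0]
    refine h1.trans_lt ?_
    nlinarith [mul_pos hε hn0]
  have hexp : Tendsto (fun n : ℕ => (kappa ν (t n) * intSum T η (t n) n ω -
      extSum T η (t n) n ω + 1) / n * Complex.exp (-centring ν s n)) atTop (𝓝 0) := by
    rw [tendsto_zero_iff_norm_tendsto_zero] at hcomp ⊢
    simpa only [norm_mul, norm_exp_neg_centring, mul_one] using hcomp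
  have hinv : Tendsto (fun n : ℕ => ((n : ℂ))⁻¹) atTop (𝓝 0) := tendsto_inv_atTop_nhds_zero_nat
  have hinv' : Tendsto (fun n : ℕ => ((n : ℂ))⁻¹ * Complex.exp (-centring ν s n)) atTop (𝓝 0) := by
    rw [tendsto_zero_iff_norm_tendsto_zero] at hinv ⊢
    simpa only [norm_mul, norm_exp_neg_centring, mul_one] using hinv
  have hall := ((hexp.add (hext.mul (hinv.const_add 1))).sub hinv').div hκ one_ne_zero
  rw [add_zero, mul_one, zero_add, sub_zero, div_one] at hall
  refine hall.congr' ?_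
  filter_upwards [hκ.eventually_ne one_ne_zero, eventually_gt_atTop 0] with n hn hn0
  have h1 : (n : ℂ) ≠ 0 := by exact_mod_cast hn0.ne'
  have h2 : (n : ℂ) + 1 ≠ 0 := by exact_mod_cast n.succ_ne_zero
  simp only [Pi.div_apply, ht] at hn ⊢
  generalize kappa ν ((scale n : ℝ)⁻¹ • s) = κ at hn ⊢
  generalize intSum T η ((scale n : ℝ)⁻¹ • s) n ω = G
  field_simp
  ring

lemma IsLabelledBST.ae_tendsto_nodes (hM : IsLabelledBST P T η ν)
    (hν : Integrable (fun x => ‖x.1‖ ^ 2 + ‖x.2‖ ^ 2) ν) (s : 𝔼) : ∀ᵐ ω ∂P, Tendsto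
      (fun n : ℕ => (intSum T η ((scale n : ℝ)⁻¹ • s) n ω + extSum T η ((scale n : ℝ)⁻¹ • s) n ω) /
        (2 * n + 1) * Complex.exp (-centring ν s n)) atTop
      (𝓝 (Complex.exp (-(quadForm ν s : ℂ) / 2))) := by
  filter_upwards [hM.ae_tendsto_extSum hν s, hM.ae_tendsto_intSum hν s] with ω h1 h2
  -- The measure over all nodes is the mixture of the internal and external ones with weights
  -- n/(2n+1) and (n+1)/(2n+1); both have the same limit.
  have h3 : Tendsto (fun n : ℕ => (n : ℂ) / (2 * n + 1)) atTop (𝓝 (1 / 2)) := by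
    have h4 : Tendsto (fun n : ℕ => (1 : ℂ) / (2 + (n : ℂ)⁻¹)) atTop (𝓝 (1 / (2 + 0))) :=
      tendsto_const_nhds.div (tendsto_inv_atTop_nhds_zero_nat.const_add 2) (by norm_num)
    rw [add_zero] at h4
    refine h4.congr' ?_
    filter_upwards [eventually_gt_atTop 0] with n hn
    have : (n : ℂ) ≠ 0 := by exact_mod_cast hn.ne'
    field_simp
  have h5 := (h2.mul h3).add (h1.mul (h3.const_sub 1))
  rw [show Complex.exp (-(quadForm ν s : ℂ) / 2) * (1 / 2) +
    Complex.exp (-(quadForm ν s : ℂ) / 2) * (1 - 1 / 2) = Complex.exp (-(quadForm ν s : ℂ) / 2) by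
      ring] at h5
  refine h5.congr' ?_
  filter_upwards [eventually_gt_atTop 0] with n hn
  have h6 : (n : ℂ) ≠ 0 := by exact_mod_cast hn.ne'
  have h7 : (n : ℂ) + 1 ≠ 0 := by exact_mod_cast n.succ_ne_zero
  have h8 : 2 * (n : ℂ) + 1 ≠ 0 := by exact_mod_cast (2 * n).succ_ne_zero
  have h9 : 1 - (n : ℂ) / (2 * n + 1) = (n + 1) / (2 * n + 1) := by
    rw [eq_div_iff h8, sub_mul, div_mul_cancel₀ _ h8]
    ring
  rw [h9]
  field_simp

/-- Reduction of the weak limit theorem to pointwise limits of characteristic functions at the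
integer scale. -/
lemma IsLabelledBST.ae_tendsto_rescale (hM : IsLabelledBST P T η ν)
    (hν : Integrable (fun x => ‖x.1‖ ^ 2 + ‖x.2‖ ^ 2) ν) (σ : BinTree → Finset Node)
    (hσ : ∀ᵐ ω ∂P, ∀ᶠ n in atTop, (σ (T n ω)).Nonempty)
    (h : ∀ s : 𝔼, ∀ᵐ ω ∂P, Tendsto
      (fun n : ℕ => charSum ((scale n : ℝ)⁻¹ • s) (σ (T n ω)) (fun v => η v ω) /
        (σ (T n ω)).card * Complex.exp (-centring ν s n)) atTop
      (𝓝 (Complex.exp (-(quadForm ν s : ℂ) / 2)))) :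
    ∀ᵐ ω ∂P, Tendsto (fun n : ℕ => rescale √(Real.log n) (Real.log n • meanSum ν)
      (empirical (σ (T n ω)) (walk fun v => η v ω))) atTop
      (𝓝 (normalLaw (secondMomentSum ν))) := by
  have hweak : ∀ᵐ ω ∂P, Tendsto (fun n : ℕ => rescale (scale n) (Real.log n • meanSum ν)
      (empirical (σ (T n ω)) (walk fun v => η v ω))) atTop
      (𝓝 (normalLaw (secondMomentSum ν))) := by
    refine ae_tendsto_of_forall_ae_tendsto_charFun P (fun n s => ?_) fun s => ?_
    · simp only [charFun_rescale]
      exact (measurable_charFun_empirical (hM.bst.measurable n) hM.measurable σ _).mul_const _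
    · filter_upwards [h s, hσ] with ω h1 h2
      rw [charFun_normalLaw hν]
      refine h1.congr' (h2.mono fun n hn => ?_)
      simp only [charFun_rescale, charFun_empirical hn, centring]
  filter_upwards [hweak] with ω hω
  refine ProbabilityMeasure.tendsto_of_tendsto_charFun fun s => ?_
  -- Replacing the integer scale by √(log n) multiplies the argument of the characteristic function
  -- by their ratio, which tends to 1; the centring already uses log n itself.
  refine (tendsto_charFun_smul hω tendsto_scale_div s).congr' ?_
  filter_upwards [tendsto_scale.eventually_gt_atTop 0] with n hn
  have hn' : (scale n : ℝ) ≠ 0 := by exact_mod_cast hn.ne'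
  rw [charFun_rescale, charFun_rescale, smul_smul,
    show (scale n : ℝ)⁻¹ * (scale n / √(Real.log n)) = (√(Real.log n))⁻¹ by field_simp]

lemma IsLabelledBST.ae_tendsto_rescale_external (hM : IsLabelledBST P T η ν)
    (hν : Integrable (fun x => ‖x.1‖ ^ 2 + ‖x.2‖ ^ 2) ν) :
    ∀ᵐ ω ∂P, Tendsto (fun n : ℕ => rescale √(Real.log n) (Real.log n • meanSum ν)
      (empirical (T n ω).external (walk fun v => η v ω))) atTop
      (𝓝 (normalLaw (secondMomentSum ν))) := by
  refine hM.ae_tendsto_rescale hν BinTree.external ?_ fun s => ?_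
  · filter_upwards [hM.ae_split] with ω hω
    exact Eventually.of_forall fun n => Finset.card_pos.1 (by rw [(hω n).2.2.1]; exact n.succ_pos)
  · filter_upwards [hM.ae_split, hM.ae_tendsto_extSum hν s] with ω hω h
    refine h.congr fun n => ?_
    rw [(hω n).2.2.1, extSum]
    push_cast
    rfl

lemma IsLabelledBST.ae_tendsto_rescale_internal (hM : IsLabelledBST P T η ν)
    (hν : Integrable (fun x => ‖x.1‖ ^ 2 + ‖x.2‖ ^ 2) ν) :
    ∀ᵐ ω ∂P, Tendsto (fun n : ℕ => rescale √(Real.log n) (Real.log n • meanSum ν)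
      (empirical (T n ω).internal (walk fun v => η v ω))) atTop
      (𝓝 (normalLaw (secondMomentSum ν))) := by
  refine hM.ae_tendsto_rescale hν BinTree.internal ?_ fun s => ?_
  · filter_upwards [hM.ae_split] with ω hω
    filter_upwards [eventually_gt_atTop 0] with n hn
    exact Finset.card_pos.1 (by rw [(hω n).2.1]; exact hn)
  · filter_upwards [hM.ae_split, hM.ae_tendsto_intSum hν s] with ω hω h
    refine h.congr fun n => ?_
    rw [(hω n).2.1, intSum]

lemma IsLabelledBST.ae_tendsto_rescale_nodes (hM : IsLabelledBST P T η ν)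
    (hν : Integrable (fun x => ‖x.1‖ ^ 2 + ‖x.2‖ ^ 2) ν) :
    ∀ᵐ ω ∂P, Tendsto (fun n : ℕ => rescale √(Real.log n) (Real.log n • meanSum ν)
      (empirical (T n ω).nodes (walk fun v => η v ω))) atTop
      (𝓝 (normalLaw (secondMomentSum ν))) := by
  refine hM.ae_tendsto_rescale hν BinTree.nodes ?_ fun s => ?_
  · filter_upwards [hM.ae_split] with ω hω
    refine Eventually.of_forall fun n => ?_
    obtain ⟨v, hv, -⟩ := (hω n).2.2.2
    exact ⟨v, Finset.mem_union_right _ hv⟩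
  · filter_upwards [hM.ae_split, hM.ae_tendsto_nodes hν s] with ω hω h
    refine h.congr fun n => ?_
    obtain ⟨hp, hi, he, -⟩ := hω n
    rw [BinTree.nodes, Finset.card_union_of_disjoint hp.disjoint, hi, he, charSum,
      Finset.sum_union hp.disjoint, intSum, extSum, charSum, charSum]
    push_cast
    ring

end Limit

end BSTWalk

theorem theorem10p1 {d : ℕ} {Ω : Type*} [MeasurableSpace Ω] (P : Measure Ω)
    [IsProbabilityMeasure P]
    (T : ℕ → Ω → BSTWalk.BinTree) (hT : BSTWalk.IsRandomBST P T)
    (ν : Measure (EuclideanSpace ℝ (Fin d) × EuclideanSpace ℝ (Fin d)))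
    [IsProbabilityMeasure ν]
    (hν : Integrable (fun x => ‖x.1‖ ^ 2 + ‖x.2‖ ^ 2) ν)
    (η : BSTWalk.Node → Ω → EuclideanSpace ℝ (Fin d) × EuclideanSpace ℝ (Fin d))
    (hη_meas : ∀ v, Measurable (η v))
    (hη_law : ∀ v, P.map (η v) = ν)
    (hη_indep : iIndepFun η P)
    (hTη : IndepFun (fun ω n => T n ω) (fun ω v => η v ω) P) :
    (∀ᵐ ω ∂P, Tendsto
      (fun n : ℕ => BSTWalk.rescale √(Real.log n) (Real.log n • BSTWalk.meanSum ν)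
        (BSTWalk.empirical (T n ω).nodes (BSTWalk.walk fun v => η v ω)))
      atTop (𝓝 (BSTWalk.normalLaw (BSTWalk.secondMomentSum ν)))) ∧
    (∀ᵐ ω ∂P, Tendsto
      (fun n : ℕ => BSTWalk.rescale √(Real.log n) (Real.log n • BSTWalk.meanSum ν)
        (BSTWalk.empirical (T n ω).internal (BSTWalk.walk fun v => η v ω)))
      atTop (𝓝 (BSTWalk.normalLaw (BSTWalk.secondMomentSum ν)))) ∧
    (∀ᵐ ω ∂P, Tendsto
      (fun n : ℕ => BSTWalk.rescale √(Real.log n) (Real.log n • BSTWalk.meanSum ν)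
        (BSTWalk.empirical (T n ω).external (BSTWalk.walk fun v => η v ω)))
      atTop (𝓝 (BSTWalk.normalLaw (BSTWalk.secondMomentSum ν)))) := by
  have hM : BSTWalk.IsLabelledBST P T η ν := ⟨hT, hη_meas, hη_law, hη_indep, hTη⟩
  exact ⟨hM.ae_tendsto_rescale_nodes hν, hM.ae_tendsto_rescale_internal hν,
    hM.ae_tendsto_rescale_external hν⟩
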